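/- **Setting.** Let $\mathfrak h$ be a real Hilbert space, $\mathfrak h_{\mathbb C}$ its complexification (inner products conjugate linear in the first argument, conjugation $k\mapsto\overline k$), and $\mathfrak H=\bigoplus_{n\ge 0}\mathfrak h_{\mathbb C}^{\odot n}$ the symmetric Fock space with exponential vectors $\mathcal E(f)=\sum_n f^{\otimes n}/\sqrt{n!}$. On exponential vectors let $a(h)\mathcal E(f)=\langle h,f\rangle\mathcal E(f)$, let $a^+(h)$ be the creation operator (the adjoint of $a(h)$), and put $Q(k)=a(\overline k)+a^+(k)$, $P(k)=i(a(\overline k)-a^+(k))$ for $k\in\mathfrak h_{\mathbb C}$. For $h_1,h_2\in\mathfrak h$ let $U(h_1,h_2)=\exp(iP(h_1)+iQ(h_2))$ be the unitary Weyl operator; with $z=h_1+ih_2$ it acts by $U(h_1,h_2)\mathcal E(f)=e^{-\|z\|^2/2-\langle z,f\rangle}\mathcal E(f+z)$. Let $h=(h_1,h_2)\in\mathfrak h^2$ and $\mathcal F^{-1}\varphi(u,v)=\frac1{2\pi}\int\varphi(x,y)e^{-i(ux+vy)}\,dx\,dy$. $\mathrm{Dom}\,O_h$ is the set of the functions $\varphi:\mathbb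 R^2\to\mathbb C$ (measurable, and integrable after division by some power of $1+|(x,y)|$, so that $\mathcal F^{-1}\varphi$ is a tempered distribution) for which there is a bounded operator $M$ on $\mathfrak H$ with $$\langle\mathcal E(f),M\mathcal E(g)\rangle=\frac1{2\pi}\int\langle\mathcal E(f),U(uh_1,vh_2)\mathcal E(g)\rangle\,\mathcal F^{-1}\varphi(u,v)\,du\,dv\qquad\text{for all }f,g\in\mathfrak h_{\mathbb C};$$ this $M$ is unique and is denoted by $O_h(\varphi)$. Here $\int G\,\mathcal F^{-1}\varphi$ means $\lim_{\varepsilon\downarrow0}$ of the pairing of the tempered distribution $\mathcal F^{-1}\varphi$ with $G(u,v)e^{-\varepsilon(u^2+v^2)}$ (which is the pairing with $G$ if $G$ is a Schwartz function, as it is for $h_1,h_2\neq0$, and the Lebesgue integral if $\mathcal F^{-1}\varphi$ is a function and $G\,\mathcal F^{-1}\varphi$ is integrable). **Proposition.** Let $h=(h_1,h_2)\in\mathfrak h^2$. (a) For all $k=(k_1,k_2)\in\mathfrak h^2$ and $\varphi\in\mathrm{Dom}\,O_h$, the function $T\varphi(x,y)=\varphi(x+\langle k_1,h_1\rangle,\,y+\langle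 k_2,h_2\rangle)$ belongs to $\mathrm{Dom}\,O_h$, and $$U(-k_2/2,k_1/2)\,O_h(\varphi)\,U(-k_2/2,k_1/2)^*=O_h(T\varphi).$$ (b) Let $k=(k_1,k_2)\in\mathfrak h_{\mathbb C}^2$ and let $\varphi\in\mathrm{Dom}\,O_h$ have partial derivatives $\frac{\partial\varphi}{\partial x},\frac{\partial\varphi}{\partial y}\in\mathrm{Dom}\,O_h$ (in the sense of tempered distributions, which includes classical derivatives). Then $[Q(\overline k_1)-P(\overline k_2),O_h(\varphi)]$ defines a bounded operator, that is, there is a bounded operator $C$ with $$\langle\mathcal E(f),C\mathcal E(g)\rangle=\langle X^*\mathcal E(f),O_h(\varphi)\mathcal E(g)\rangle-\langle\mathcal E(f),O_h(\varphi)X\mathcal E(g)\rangle$$ for all $f,g\in\mathfrak h_{\mathbb C}$, where $X=Q(\overline k_1)-P(\overline k_2)$ and $X^*=Q(k_1)-P(k_2)$; moreover $\langle k_1,h_1\rangle\frac{\partial\varphi}{\partial x}+\langle k_2,h_2\rangle\frac{\partial\varphi}{\partial y}\in\mathrm{Dom}\,O_h$ and $$\frac i2\,[Q(\overline k_1)-P(\overline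 k_2),O_h(\varphi)]=O_h\Big(\langle k_1,h_1\rangle\frac{\partial\varphi}{\partial x}+\langle k_2,h_2\rangle\frac{\partial\varphi}{\partial y}\Big).$$ -/

import Mathlib

open scoped TensorProduct ComplexConjugate

noncomputable section

set_option linter.unusedSectionVars false

namespace QuantumWiener

/-! ### The complexification of a real Hilbert space -/

/-- The complexification of a real inner product space: formal sums `re + i im`. -/
@[ext]
structure Complexification (E : Type*) where
  re : E
  im : E

namespace Complexification

variable {E : Type*} [NormedAddCommGroup E] [InnerProductSpace ℝ E]

/-- The underlying pair of a vector of the complexification. -/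
def equivProd (E : Type*) : Complexification E ≃ E × E where
  toFun x := (x.re, x.im)
  invFun p := ⟨p.1, p.2⟩

instance : AddCommGroup (Complexification E) := (equivProd E).addCommGroup

@[simp] theorem re_add (x y : Complexification E) : (x + y).re = x.re + y.re := rfl
@[simp] theorem im_add (x y : Complexification E) : (x + y).im = x.im + y.im := rfl
@[simp] theorem re_zero : (0 : Complexification E).re = 0 := rfl
@[simp] theorem im_zero : (0 : Complexification E).im = 0 := rfl

instance : SMul ℂ (Complexification E) :=
  ⟨fun c x => ⟨c.re • x.re - c.im • x.im, c.re • x.im + c.im • x.re⟩⟩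

@[simp] theorem re_smul (c : ℂ) (x : Complexification E) :
    (c • x).re = c.re • x.re - c.im • x.im := rfl
@[simp] theorem im_smul (c : ℂ) (x : Complexification E) :
    (c • x).im = c.re • x.im + c.im • x.re := rfl

instance : Module ℂ (Complexification E) where
  one_smul x := by ext <;> simp
  mul_smul a b x := by
    ext
    · simp only [re_smul, im_smul, Complex.mul_re, Complex.mul_im]; module
    · simp only [re_smul, im_smul, Complex.mul_re, Complex.mul_im]; module
  smul_zero a := by ext <;> simp
  smul_add a x y := by
    ext
    · simp only [re_smul, re_add, im_add]; module
    · simp only [im_smul, re_add, im_add]; module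
  add_smul a b x := by
    ext
    · simp only [re_smul, re_add, Complex.add_re, Complex.add_im]; module
    · simp only [im_smul, im_add, Complex.add_re, Complex.add_im]; module
  zero_smul x := by ext <;> simp

/-- The sesquilinear extension (conjugate linear in the first argument) of the real inner
product. -/
@[reducible] def core : InnerProductSpace.Core ℂ (Complexification E) where
  inner x y := ⟨inner ℝ x.re y.re + inner ℝ x.im y.im, inner ℝ x.re y.im - inner ℝ x.im y.re⟩
  conj_inner_symm x y := by
    apply Complex.ext
    · simp [real_inner_comm]
    · simp [real_inner_comm]
  re_inner_nonneg x := add_nonneg real_inner_self_nonneg real_inner_self_nonneg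
  add_left x y z := by
    apply Complex.ext
    · simp [inner_add_left]; ring
    · simp [inner_add_left]; ring
  smul_left x y c := by
    apply Complex.ext
    · simp [inner_add_left, inner_sub_left, real_inner_smul_left]; ring
    · simp [inner_add_left, inner_sub_left, real_inner_smul_left]; ring
  definite x h := by
    have h1 : inner ℝ x.re x.re + inner ℝ x.im x.im = 0 := congrArg Complex.re h
    have h2 : 0 ≤ inner ℝ x.re x.re := real_inner_self_nonneg
    have h3 : 0 ≤ inner ℝ x.im x.im := real_inner_self_nonneg
    ext
    · exact inner_self_eq_zero.1 (by linarith : inner ℝ x.re x.re = 0)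
    · exact inner_self_eq_zero.1 (by linarith : inner ℝ x.im x.im = 0)

instance : NormedAddCommGroup (Complexification E) :=
  core.toNormedAddCommGroup

instance : InnerProductSpace ℂ (Complexification E) := .ofCore core.toCore

theorem inner_def (x y : Complexification E) :
    inner ℂ x y = (⟨inner ℝ x.re y.re + inner ℝ x.im y.im,
      inner ℝ x.re y.im - inner ℝ x.im y.re⟩ : ℂ) := rfl

/-- The embedding of the real space as the real vectors. -/
def ofReal (x : E) : Complexification E := ⟨x, 0⟩

/-- The conjugation of the complexification. -/
def conjugate (x : Complexification E) : Complexification E := ⟨x.re, -x.im⟩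

end Complexification

/-! ### The symmetric Fock space -/

section Fock

variable {K : Type*} [NormedAddCommGroup K] [InnerProductSpace ℂ K]

/-- The algebraic `n`-fold tensor power over `ℂ` (a copy that does not carry the projective
norm). -/
def TensorPow (K : Type*) [NormedAddCommGroup K] [InnerProductSpace ℂ K] (n : ℕ) : Type _ :=
  ⨂[ℂ]^n K

instance (n : ℕ) : AddCommGroup (TensorPow K n) := inferInstanceAs (AddCommGroup (⨂[ℂ]^n K))
instance (n : ℕ) : Module ℂ (TensorPow K n) := inferInstanceAs (Module ℂ (⨂[ℂ]^n K))

/-- The elementary tensor `v 0 ⊗ ⋯ ⊗ v (n - 1)`. -/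
def tensorProd (n : ℕ) : MultilinearMap ℂ (fun _ : Fin n => K) (TensorPow K n) :=
  PiTensorProduct.tprod ℂ

/-- Pull back of an inner product along an injective linear map. -/
@[reducible] def coreComap {V W : Type*} [AddCommGroup V] [Module ℂ V] [NormedAddCommGroup W]
    [InnerProductSpace ℂ W] (e : V ≃ₗ[ℂ] W) : InnerProductSpace.Core ℂ V where
  inner x y := inner ℂ (e x) (e y)
  conj_inner_symm x y := inner_conj_symm _ _
  re_inner_nonneg x := inner_self_nonneg
  add_left x y z := by rw [map_add, inner_add_left]
  smul_left x y c := by rw [map_smul, inner_smul_left]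
  definite x h := by simpa using h

/-- The empty tensor power is the scalar field. -/
def tensorZero (K : Type*) [NormedAddCommGroup K] [InnerProductSpace ℂ K] :
    TensorPow K 0 ≃ₗ[ℂ] ℂ :=
  PiTensorProduct.isEmptyEquiv (Fin 0)

/-- The identification of the `(n + 1)`-st tensor power with the tensor product of the `n`-th
one and the space. -/
def tensorSucc (K : Type*) [NormedAddCommGroup K] [InnerProductSpace ℂ K] (n : ℕ) :
    TensorPow K (n + 1) ≃ₗ[ℂ] TensorPow K n ⊗[ℂ] K :=
  (TensorPower.mulEquiv (R := ℂ) (M := K) (n := n) (m := 1)).symm.trans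
    (TensorProduct.congr (LinearEquiv.refl ℂ (⨂[ℂ]^n K))
      (PiTensorProduct.subsingletonEquiv (0 : Fin 1)))

theorem tensorZero_tensorProd (v : Fin 0 → K) : tensorZero K (tensorProd 0 v) = 1 :=
  PiTensorProduct.isEmptyEquiv_apply_tprod _ _

theorem tensorSucc_tensorProd (n : ℕ) (v : Fin (n + 1) → K) :
    tensorSucc K n (tensorProd (n + 1) v) =
      tensorProd n (fun i => v i.castSucc) ⊗ₜ[ℂ] v (Fin.last n) := by
  have h : (PiTensorProduct.tprod ℂ v : ⨂[ℂ]^(n + 1) K) =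
      TensorPower.mulEquiv ((PiTensorProduct.tprod ℂ fun i : Fin n => v i.castSucc) ⊗ₜ[ℂ]
        (PiTensorProduct.tprod ℂ fun _ : Fin 1 => v (Fin.last n))) := by
    rw [← TensorPower.gMul_def, TensorPower.tprod_mul_tprod]
    congr 1
    ext i
    refine Fin.lastCases ?_ (fun j => ?_) i
    · exact (Fin.append_right (fun i : Fin n => v i.castSucc)
        (fun _ : Fin 1 => v (Fin.last n)) 0).symm
    · exact (Fin.append_left (fun i : Fin n => v i.castSucc)
        (fun _ : Fin 1 => v (Fin.last n)) j).symm
  change (TensorProduct.congr _ _) (TensorPower.mulEquiv.symm (PiTensorProduct.tprod ℂ v)) = _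
  rw [h, LinearEquiv.symm_apply_apply]
  erw [TensorProduct.congr_tmul]
  rw [PiTensorProduct.subsingletonEquiv_apply_tprod]
  rfl

/-- The inner product on the tensor powers, for which
`⟪u₁ ⊗ ⋯ ⊗ uₙ, v₁ ⊗ ⋯ ⊗ vₙ⟫ = ∏ i, ⟪uᵢ, vᵢ⟫`; see `inner_tensorProd`. -/
@[reducible] def tensorCore : (n : ℕ) → InnerProductSpace.Core ℂ (TensorPow K n)
  | 0 => coreComap (tensorZero K)
  | n + 1 =>
    letI : NormedAddCommGroup (TensorPow K n) := (tensorCore n).toNormedAddCommGroup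
    letI : InnerProductSpace ℂ (TensorPow K n) := .ofCore (tensorCore n).toCore
    coreComap (tensorSucc K n)

instance (n : ℕ) : NormedAddCommGroup (TensorPow K n) := (tensorCore n).toNormedAddCommGroup
instance (n : ℕ) : InnerProductSpace ℂ (TensorPow K n) := .ofCore (tensorCore n).toCore

theorem inner_tensorProd (n : ℕ) (u v : Fin n → K) :
    inner ℂ (tensorProd n u) (tensorProd n v) = ∏ i, inner ℂ (u i) (v i) := by
  induction n with
  | zero =>
    change inner ℂ (tensorZero K (tensorProd 0 u)) (tensorZero K (tensorProd 0 v)) = _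
    simp [tensorZero_tensorProd]
  | succ n ih =>
    change inner ℂ (tensorSucc K n (tensorProd (n + 1) u))
      (tensorSucc K n (tensorProd (n + 1) v)) = _
    rw [tensorSucc_tensorProd, tensorSucc_tensorProd, TensorProduct.inner_tmul, ih,
      Fin.prod_univ_castSucc]


theorem norm_tensorProd (n : ℕ) (v : Fin n → K) : ‖tensorProd n v‖ = ∏ i, ‖v i‖ := by
  have h := inner_tensorProd n v v
  simp only [inner_self_eq_norm_sq_to_K] at h
  rw [Finset.prod_pow] at h
  have h2 : ‖tensorProd n v‖ ^ 2 = (∏ i, ‖v i‖) ^ 2 := by exact_mod_cast h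
  exact (sq_eq_sq₀ (norm_nonneg _) (Finset.prod_nonneg fun _ _ => norm_nonneg _)).1 h2

/-- The elementary tensors as vectors of the Hilbert space tensor power, which is the completion
of the algebraic one. -/
def hilbertProd (K : Type*) [NormedAddCommGroup K] [InnerProductSpace ℂ K] (n : ℕ) :
    ContinuousMultilinearMap ℂ (fun _ : Fin n => K) (UniformSpace.Completion (TensorPow K n)) :=
  (UniformSpace.Completion.toComplL (𝕜 := ℂ)).compContinuousMultilinearMap
    ((tensorProd n).mkContinuous 1 fun v => by rw [norm_tensorProd, one_mul])

theorem inner_hilbertProd (n : ℕ) (u v : Fin n → K) :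
    inner ℂ (hilbertProd K n u) (hilbertProd K n v) = ∏ i, inner ℂ (u i) (v i) :=
  (UniformSpace.Completion.inner_coe _ _).trans (inner_tensorProd n u v)

theorem norm_hilbertProd (n : ℕ) (v : Fin n → K) : ‖hilbertProd K n v‖ = ∏ i, ‖v i‖ :=
  (UniformSpace.Completion.norm_coe _).trans (norm_tensorProd n v)

/-- The symmetric tensor power: the closed subspace of the Hilbert space tensor power that is
spanned by the powers `v ⊗ ⋯ ⊗ v` (by polarization these span the symmetric tensors). -/
def symPow (K : Type*) [NormedAddCommGroup K] [InnerProductSpace ℂ K] (n : ℕ) :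
    Submodule ℂ (UniformSpace.Completion (TensorPow K n)) :=
  (Submodule.span ℂ (Set.range fun v : K => hilbertProd K n fun _ => v)).topologicalClosure

instance (n : ℕ) : CompleteSpace (symPow K n) :=
  inferInstanceAs (CompleteSpace (Submodule.topologicalClosure _))

theorem isClosed_symPow (n : ℕ) :
    IsClosed (symPow K n : Set (UniformSpace.Completion (TensorPow K n))) :=
  Submodule.isClosed_topologicalClosure _

theorem pow_mem_symPow (n : ℕ) (v : K) : hilbertProd K n (fun _ => v) ∈ symPow K n :=
  Submodule.le_topologicalClosure _ (Submodule.subset_span ⟨v, rfl⟩)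

/-- The symmetrization `∑ j, f ⊗ ⋯ ⊗ h ⊗ ⋯ ⊗ f`, with the factor `h` in the place `j`. -/
def symInsert (n : ℕ) (f h : K) : UniformSpace.Completion (TensorPow K n) :=
  ∑ j : Fin n, hilbertProd K n (Function.update (fun _ => f) j h)

theorem symInsert_mem_symPow (n : ℕ) (f h : K) : symInsert n f h ∈ symPow K n := by
  have hd : HasDerivAt (fun t : ℂ => hilbertProd K n fun _ => f + t • h) (symInsert n f h) 0 := by
    have h1 : HasDerivAt (fun t : ℂ => (fun _ : Fin n => f + t • h)) (fun _ => h) 0 := by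
      rw [hasDerivAt_pi]
      intro i
      simpa using ((hasDerivAt_id (0 : ℂ)).smul_const h).const_add f
    have h2 := ((hilbertProd K n).hasFDerivAt (fun _ : Fin n => f + (0 : ℂ) • h)).comp_hasDerivAt
      (0 : ℂ) h1
    simpa [symInsert, ContinuousMultilinearMap.linearDeriv_apply, Function.comp_def] using h2
  have hs := hd.tendsto_slope
  refine (isClosed_symPow n).mem_of_tendsto hs (Filter.Eventually.of_forall fun t => ?_)
  rw [slope_def_module]
  exact (symPow K n).smul_mem _ ((symPow K n).sub_mem (pow_mem_symPow n _) (pow_mem_symPow n _))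

theorem norm_symInsert_le (n : ℕ) (f h : K) :
    ‖symInsert n f h‖ ≤ n * (‖f‖ ^ (n - 1) * ‖h‖) := by
  refine (norm_sum_le _ _).trans ?_
  have : ∀ j : Fin n, ‖hilbertProd K n (Function.update (fun _ => f) j h)‖ =
      ‖f‖ ^ (n - 1) * ‖h‖ := by
    intro j
    rw [norm_hilbertProd, ← Finset.mul_prod_erase _ _ (Finset.mem_univ j), mul_comm]
    rw [Function.update_self, Finset.prod_congr rfl (g := fun _ => ‖f‖)]
    · simp
    · intro i hi
      rw [Function.update_of_ne (Finset.ne_of_mem_erase hi)]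
  simp [this]

theorem inner_pow_symInsert (n : ℕ) (e f h : K) :
    inner ℂ (hilbertProd K n fun _ => e) (symInsert n f h) =
      n * (inner ℂ e f ^ (n - 1) * inner ℂ e h) := by
  have : ∀ j : Fin n, inner ℂ (hilbertProd K n fun _ => e)
      (hilbertProd K n (Function.update (fun _ => f) j h)) =
      inner ℂ e f ^ (n - 1) * inner ℂ e h := by
    intro j
    rw [inner_hilbertProd, ← Finset.mul_prod_erase _ _ (Finset.mem_univ j), mul_comm]
    rw [Function.update_self, Finset.prod_congr rfl (g := fun _ => inner ℂ e f)]
    · simp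
    · intro i hi
      rw [Function.update_of_ne (Finset.ne_of_mem_erase hi)]
  simp [symInsert, inner_sum, this]

/-- The symmetric Fock space: the Hilbert space direct sum of the symmetric tensor powers. -/
abbrev Fock (K : Type*) [NormedAddCommGroup K] [InnerProductSpace ℂ K] : Type _ :=
  lp (fun n : ℕ => symPow K n) 2

/-- The scalar `1 / √n!`. -/
def invSqrtFactorial (n : ℕ) : ℂ := ((√(n.factorial : ℝ))⁻¹ : ℝ)

theorem norm_invSqrtFactorial_sq (n : ℕ) : ‖invSqrtFactorial n‖ ^ 2 = (n.factorial : ℝ)⁻¹ := by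
  rw [invSqrtFactorial, Complex.norm_real, Real.norm_eq_abs, sq_abs, inv_pow,
    Real.sq_sqrt (Nat.cast_nonneg _)]

theorem conj_invSqrtFactorial_mul (n : ℕ) :
    conj (invSqrtFactorial n) * invSqrtFactorial n = ((n.factorial : ℂ))⁻¹ := by
  rw [mul_comm, Complex.mul_conj', ← Complex.ofReal_pow, norm_invSqrtFactorial_sq]
  push_cast
  rfl

/-- The exponential vector `∑ n, f ^ ⊗ n / √n!`. -/
def expVec (f : K) : Fock K :=
  ⟨fun n => invSqrtFactorial n • ⟨hilbertProd K n fun _ => f, pow_mem_symPow n f⟩, by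
    refine memℓp_gen ?_
    have h := Real.summable_pow_div_factorial (‖f‖ ^ 2)
    refine h.congr fun n => ?_
    simp only [ENNReal.toReal_ofNat, Real.rpow_ofNat]
    rw [norm_smul, mul_pow, norm_invSqrtFactorial_sq, Submodule.coe_norm, norm_hilbertProd]
    simp only [Finset.prod_const, Finset.card_univ, Fintype.card_fin]
    rw [← pow_mul, ← pow_mul, mul_comm n 2, div_eq_inv_mul]⟩

/-- The vector `a⁺(h) (expVec f)`. On `n`-particle vectors `a⁺(h)` is `√(n + 1)` times the
symmetric tensor product with `h`, hence the `n`-particle component of this vector is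
`(∑ j, f ⊗ ⋯ ⊗ h ⊗ ⋯ ⊗ f) / √n!`. -/
def creationVec (h f : K) : Fock K :=
  ⟨fun n => invSqrtFactorial n • ⟨symInsert n f h, symInsert_mem_symPow n f h⟩, by
    refine memℓp_gen ?_
    simp only [ENNReal.toReal_ofNat, Real.rpow_ofNat]
    rw [← summable_nat_add_iff 1]
    have hs := (Real.summable_pow_div_factorial (2 * ‖f‖ ^ 2)).mul_right (‖h‖ ^ 2)
    refine Summable.of_nonneg_of_le (fun n => by positivity) (fun n => ?_) hs
    rw [norm_smul, mul_pow, norm_invSqrtFactorial_sq, Submodule.coe_norm]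
    have h1 := norm_symInsert_le (n + 1) f h
    have h2 : ‖symInsert (n + 1) f h‖ ^ 2 ≤ ((n + 1 : ℕ) * (‖f‖ ^ n * ‖h‖)) ^ 2 := by
      gcongr
      simpa using h1
    have h3 : ((n : ℝ) + 1) ≤ 2 ^ n := by exact_mod_cast Nat.lt_two_pow_self
    calc ((n + 1).factorial : ℝ)⁻¹ * ‖symInsert (n + 1) f h‖ ^ 2
        ≤ ((n + 1).factorial : ℝ)⁻¹ * ((n + 1 : ℕ) * (‖f‖ ^ n * ‖h‖)) ^ 2 := by gcongr
      _ = ((n : ℝ) + 1) * ((‖f‖ ^ 2) ^ n / n.factorial * ‖h‖ ^ 2) := by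
          rw [Nat.factorial_succ]
          push_cast
          field_simp
          ring
      _ ≤ 2 ^ n * ((‖f‖ ^ 2) ^ n / n.factorial * ‖h‖ ^ 2) := by gcongr
      _ = (2 * ‖f‖ ^ 2) ^ n / n.factorial * ‖h‖ ^ 2 := by rw [mul_pow]; ring⟩

theorem inner_expVec (f g : K) : inner ℂ (expVec f) (expVec g) = Complex.exp (inner ℂ f g) := by
  refine (lp.hasSum_inner (𝕜 := ℂ) (expVec f) (expVec g)).unique ?_
  have h := NormedSpace.expSeries_div_hasSum_exp (𝔸 := ℂ) (inner ℂ f g)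
  rw [← Complex.exp_eq_exp_ℂ] at h
  refine h.congr_fun fun n => ?_
  change inner ℂ (invSqrtFactorial n • (hilbertProd K n fun _ => f))
    (invSqrtFactorial n • (hilbertProd K n fun _ => g)) = _
  rw [inner_smul_left, inner_smul_right, ← mul_assoc, conj_invSqrtFactorial_mul,
    inner_hilbertProd]
  simp [div_eq_inv_mul]

theorem inner_expVec_creationVec (h f g : K) :
    inner ℂ (expVec f) (creationVec h g) = inner ℂ f h * Complex.exp (inner ℂ f g) := by
  refine (lp.hasSum_inner (𝕜 := ℂ) (expVec f) (creationVec h g)).unique ?_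
  have hs := (NormedSpace.expSeries_div_hasSum_exp (𝔸 := ℂ) (inner ℂ f g)).mul_left (inner ℂ f h)
  rw [← Complex.exp_eq_exp_ℂ] at hs
  rw [← hasSum_nat_add_iff' 1]
  have key : ∀ n, inner ℂ ((expVec f : ∀ n, symPow K n) n) ((creationVec h g : ∀ n, symPow K n) n) =
      ((n.factorial : ℂ))⁻¹ * (n * (inner ℂ f g ^ (n - 1) * inner ℂ f h)) := by
    intro n
    change inner ℂ (invSqrtFactorial n • (hilbertProd K n fun _ => f))
      (invSqrtFactorial n • symInsert n g h) = _
    rw [inner_smul_left, inner_smul_right, ← mul_assoc, conj_invSqrtFactorial_mul,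
      inner_pow_symInsert]
  simp only [key, Finset.sum_range_one, Nat.cast_zero, zero_mul, mul_zero, sub_zero]
  refine hs.congr_fun fun n => ?_
  rw [Nat.factorial_succ]
  push_cast
  have h1 : (n : ℂ) + 1 ≠ 0 := by exact_mod_cast Nat.succ_ne_zero n
  have h2 : (n.factorial : ℂ) ≠ 0 := by exact_mod_cast n.factorial_ne_zero
  field_simp

/-- The exponential vectors are total. -/
theorem eq_zero_of_inner_expVec {ψ : Fock K} (hψ : ∀ f : K, inner ℂ ψ (expVec f) = 0) :
    ψ = 0 := by
  have key : ∀ (f : K) (n : ℕ),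
      inner ℂ ((ψ n : symPow K n) : UniformSpace.Completion (TensorPow K n))
        (hilbertProd K n fun _ => f) = 0 := by
    intro f
    let a : ℕ → ℂ := fun n => invSqrtFactorial n *
      inner ℂ ((ψ n : symPow K n) : UniformSpace.Completion (TensorPow K n))
        (hilbertProd K n fun _ => f)
    have hsum : ∀ t : ℂ, HasSum (fun n => t ^ n • a n) 0 := by
      intro t
      have h := lp.hasSum_inner (𝕜 := ℂ) ψ (expVec (t • f))
      rw [hψ] at h
      refine h.congr_fun fun n => ?_
      change _ = inner ℂ ((ψ n : symPow K n) : UniformSpace.Completion (TensorPow K n))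
        (invSqrtFactorial n • hilbertProd K n fun _ => t • f)
      have hm : hilbertProd K n (fun _ => t • f) = t ^ n • hilbertProd K n fun _ => f := by
        simpa using (hilbertProd K n).map_smul_univ (fun _ => t) (fun _ => f)
      rw [hm, inner_smul_right, inner_smul_right, smul_eq_mul]
      ring
    let p : FormalMultilinearSeries ℂ ℂ ℂ := fun n => ContinuousMultilinearMap.mkPiRing ℂ (Fin n) (a n)
    have hp : HasFPowerSeriesAt (0 : ℂ → ℂ) p 0 := by
      rw [hasFPowerSeriesAt_iff]
      refine Filter.Eventually.of_forall fun z => ?_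
      simpa [p, FormalMultilinearSeries.coeff] using hsum z
    have h0 := hp.eq_zero
    intro n
    have h1 : a n = 0 := by
      have := congrArg (fun q : FormalMultilinearSeries ℂ ℂ ℂ => q.coeff n) h0
      simpa [p, FormalMultilinearSeries.coeff] using this
    refine (mul_eq_zero.1 h1).resolve_left ?_
    intro h2
    have := norm_invSqrtFactorial_sq n
    rw [h2] at this
    rw [norm_zero, zero_pow two_ne_zero, eq_comm, inv_eq_zero] at this
    exact n.factorial_ne_zero (by exact_mod_cast this)
  ext n : 2
  have hle : symPow K n ≤
      (Submodule.span ℂ {((ψ n : symPow K n) : UniformSpace.Completion (TensorPow K n))})ᗮ := by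
    refine Submodule.topologicalClosure_minimal _ ?_ (Submodule.isClosed_orthogonal _)
    rw [Submodule.span_le]
    rintro _ ⟨f, rfl⟩
    exact Submodule.mem_orthogonal_singleton_iff_inner_right.2 (key f n)
  have h := Submodule.mem_orthogonal_singleton_iff_inner_right.1 (hle (ψ n).2)
  exact Subtype.ext (inner_self_eq_zero.1 h)

theorem dense_span_expVec : DenseRange (Finsupp.linearCombination ℂ (expVec : K → Fock K)) := by
  have h : (Submodule.span ℂ (Set.range (expVec : K → Fock K))).topologicalClosure = ⊤ := by
    rw [← Submodule.orthogonal_eq_bot_iff, Submodule.orthogonal_closure, Submodule.eq_bot_iff]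
    intro ψ hψ
    refine eq_zero_of_inner_expVec fun f => ?_
    have hf : expVec f ∈ Submodule.span ℂ (Set.range (expVec : K → Fock K)) :=
      Submodule.subset_span ⟨f, rfl⟩
    exact Submodule.inner_left_of_mem_orthogonal hf hψ
  rw [← Finsupp.range_linearCombination] at h
  rw [DenseRange, ← LinearMap.coe_range]
  exact (Submodule.dense_iff_topologicalClosure_eq_top).2 h

/-- A bounded operator is determined by its matrix elements between exponential vectors. -/
theorem ext_of_inner_expVec {A B : Fock K →L[ℂ] Fock K}
    (h : ∀ f g : K, inner ℂ (expVec f) (A (expVec g)) = inner ℂ (expVec f) (B (expVec g))) :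
    A = B := by
  have h1 : ∀ g, A (expVec g) = B (expVec g) := by
    intro g
    rw [← sub_eq_zero]
    refine eq_zero_of_inner_expVec fun f => ?_
    rw [← inner_conj_symm, inner_sub_right, h f g, sub_self, map_zero]
  have h2 : (A : Fock K → Fock K) = B := by
    refine dense_span_expVec.equalizer A.continuous B.continuous ?_
    ext1 x
    simp [Finsupp.linearCombination_apply, Finsupp.sum, map_sum, h1]
  exact DFunLike.coe_injective h2

/-! ### Weyl operators -/

/-- The vector `exp (- ‖z‖² / 2 - ⟪z, f⟫) • expVec (f + z)`, the image of `expVec f` under the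
Weyl operator of `z`. -/
def weylVec (z f : K) : Fock K :=
  Complex.exp (-(inner ℂ z z) / 2 - inner ℂ z f) • expVec (f + z)

theorem inner_weylVec (z f g : K) :
    inner ℂ (weylVec z f) (weylVec z g) = inner ℂ (expVec f) (expVec g) := by
  rw [weylVec, weylVec, inner_smul_left, inner_smul_right, inner_expVec, inner_expVec,
    ← Complex.exp_conj, ← Complex.exp_add, ← Complex.exp_add]
  congr 1
  simp only [map_sub, map_neg, map_div₀, inner_conj_symm, inner_add_left, inner_add_right,
    Complex.conj_ofNat]
  ring

theorem norm_weylVec (z : K) (x : K →₀ ℂ) :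
    ‖Finsupp.linearCombination ℂ (weylVec z) x‖ = ‖Finsupp.linearCombination ℂ expVec x‖ := by
  have h : inner ℂ (Finsupp.linearCombination ℂ (weylVec z) x)
      (Finsupp.linearCombination ℂ (weylVec z) x) =
      inner ℂ (Finsupp.linearCombination ℂ (expVec : K → Fock K) x)
      (Finsupp.linearCombination ℂ expVec x) := by
    simp only [Finsupp.linearCombination_apply, Finsupp.sum, sum_inner, inner_sum,
      inner_smul_left, inner_smul_right, inner_weylVec]
  rw [norm_eq_sqrt_re_inner (𝕜 := ℂ), norm_eq_sqrt_re_inner (𝕜 := ℂ), h]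

/-- The Weyl operator of `z`, that is `exp (a⁺(z) - a(z))`: the bounded operator with
`expVec f ↦ exp (- ‖z‖² / 2 - ⟪z, f⟫) • expVec (f + z)`. -/
def weyl (z : K) : Fock K →L[ℂ] Fock K :=
  (Finsupp.linearCombination ℂ (weylVec z)).extendOfNorm (Finsupp.linearCombination ℂ expVec)

theorem weyl_expVec (z f : K) : weyl z (expVec f) = weylVec z f := by
  have h := LinearMap.extendOfNorm_eq (f := Finsupp.linearCombination ℂ (weylVec z))
    (e := Finsupp.linearCombination ℂ expVec) dense_span_expVec
    ⟨1, fun x => by rw [norm_weylVec, one_mul]⟩ (Finsupp.single f 1)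
  simpa [weyl] using h

theorem weyl_comp_weyl (z w : K) :
    weyl z ∘L weyl w = Complex.exp ((inner ℂ w z - inner ℂ z w) / 2) • weyl (z + w) := by
  refine ext_of_inner_expVec fun f g => ?_
  rw [ContinuousLinearMap.comp_apply, smul_apply, weyl_expVec, weyl_expVec, weylVec, map_smul,
    weyl_expVec, weylVec, weylVec, smul_smul, smul_smul, ← Complex.exp_add, ← Complex.exp_add,
    add_assoc g w z, add_comm w z]
  congr 3
  simp only [inner_add_left, inner_add_right]
  ring


/-! ### Operators on the exponential vectors -/

/-- An operator defined on the linear span of the exponential vectors that has an adjoint which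
is also defined there. Since the exponential vectors are linearly independent, such an operator
amounts to its values on the exponential vectors. -/
structure ExpOperator (K : Type*) [NormedAddCommGroup K] [InnerProductSpace ℂ K] where
  /-- the value on `expVec f` -/
  toFun : K → Fock K
  /-- the value of the adjoint on `expVec f` -/
  adj : K → Fock K
  inner_adj : ∀ f g : K, inner ℂ (expVec f) (toFun g) = inner ℂ (adj f) (expVec g)

instance : Add (ExpOperator K) where
  add X Y := ⟨fun f => X.toFun f + Y.toFun f, fun f => X.adj f + Y.adj f, fun f g => by
    rw [inner_add_left, inner_add_right, X.inner_adj, Y.inner_adj]⟩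

instance : Sub (ExpOperator K) where
  sub X Y := ⟨fun f => X.toFun f - Y.toFun f, fun f => X.adj f - Y.adj f, fun f g => by
    rw [inner_sub_left, inner_sub_right, X.inner_adj, Y.inner_adj]⟩

instance : SMul ℂ (ExpOperator K) where
  smul c X := ⟨fun f => c • X.toFun f, fun f => conj c • X.adj f, fun f g => by
    rw [inner_smul_left, inner_smul_right, X.inner_adj, Complex.conj_conj]⟩

/-- The annihilation operator `a(h)`, with `a(h) (expVec f) = ⟪h, f⟫ • expVec f`. -/
def annihilation (h : K) : ExpOperator K where
  toFun f := inner ℂ h f • expVec f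
  adj f := creationVec h f
  inner_adj f g := by
    rw [← inner_conj_symm (creationVec h f), inner_expVec_creationVec, inner_smul_right,
      inner_expVec, map_mul, inner_conj_symm, ← Complex.exp_conj, inner_conj_symm]

/-- The creation operator `a⁺(h)`, the adjoint of `a(h)`. -/
def creation (h : K) : ExpOperator K where
  toFun f := creationVec h f
  adj f := inner ℂ h f • expVec f
  inner_adj f g := by
    rw [inner_expVec_creationVec, inner_smul_left, inner_expVec, inner_conj_symm]

/-- The commutator `X B - B X` of an operator on the exponential vectors and a bounded operator
defines the bounded operator `C`. -/
def CommutatorDefines (X : ExpOperator K) (B C : Fock K →L[ℂ] Fock K) : Prop :=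
  ∀ f g : K, inner ℂ (expVec f) (C (expVec g)) =
    inner ℂ (X.adj f) (B (expVec g)) - inner ℂ (expVec f) (B (X.toFun g))

end Fock

/-! ### Weyl calculus over a real Hilbert space -/

section WeylCalculus

open Complexification

variable {E : Type*} [NormedAddCommGroup E] [InnerProductSpace ℝ E]

/-- The position operator `Q(k) = a(k̄) + a⁺(k)`. -/
def position (k : Complexification E) : ExpOperator (Complexification E) :=
  annihilation k.conjugate + creation k

/-- The momentum operator `P(k) = i (a(k̄) - a⁺(k))`. -/
def momentum (k : Complexification E) : ExpOperator (Complexification E) :=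
  Complex.I • (annihilation k.conjugate - creation k)

/-- The unitary Weyl operator `U(h₁, h₂) = exp (i P(h₁) + i Q(h₂)) = exp (a⁺(z) - a(z))`, where
`z = h₁ + i h₂`, for real vectors `h₁`, `h₂`. -/
def weylU (h₁ h₂ : E) : Fock (Complexification E) →L[ℂ] Fock (Complexification E) :=
  weyl (ofReal h₁ + Complex.I • ofReal h₂)

theorem inner_expVec_weylU (h₁ h₂ : E) (f g : Complexification E) :
    inner ℂ (expVec f) (weylU h₁ h₂ (expVec g)) =
      Complex.exp (inner ℂ f g - ((‖h₁‖ ^ 2 + ‖h₂‖ ^ 2 : ℝ) : ℂ) / 2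
        + (inner ℂ f (ofReal h₁) - inner ℂ (ofReal h₁) g)
        + Complex.I * (inner ℂ f (ofReal h₂) + inner ℂ (ofReal h₂) g)) := by
  have h12 : inner ℂ (ofReal h₁) (ofReal h₂) = inner ℂ (ofReal h₂) (ofReal h₁) := by
    simp [inner_def, ofReal, real_inner_comm]
  have hn : ∀ h : E, inner ℂ (ofReal h) (ofReal h) = ((‖h‖ ^ 2 : ℝ) : ℂ) := by
    intro h
    apply Complex.ext
    · rw [inner_def, Complex.ofReal_re]; simp [ofReal]
    · rw [inner_def, Complex.ofReal_im]; simp [ofReal]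
  rw [weylU, weyl_expVec, weylVec, inner_smul_right, inner_expVec, ← Complex.exp_add]
  congr 1
  simp only [inner_add_left, inner_add_right, inner_smul_left, inner_smul_right, hn, h12,
    Complex.conj_I]
  push_cast
  linear_combination ((‖h₂‖ : ℂ) ^ 2 / 2) * Complex.I_sq

/-- The derivative at `t = 0` of the one-parameter group `t ↦ U(t h₁, t h₂)` is
`i P(h₁) + i Q(h₂)`. -/
theorem hasDerivAt_inner_weylU (h₁ h₂ : E) (f g : Complexification E) :
    HasDerivAt (fun t : ℝ => inner ℂ (expVec f) (weylU (t • h₁) (t • h₂) (expVec g)))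
      (inner ℂ (expVec f) ((Complex.I • momentum (ofReal h₁) +
        Complex.I • position (ofReal h₂)).toFun g)) 0 := by
  have hc : ∀ h : E, (ofReal h).conjugate = ofReal h := fun h => by
    simp [ofReal, conjugate]
  have hs : ∀ (t : ℝ) (h : E), ofReal (t • h) = (t : ℂ) • ofReal h := fun t h => by
    apply Complexification.ext
    · rw [re_smul]; simp [ofReal]
    · rw [im_smul]; simp [ofReal]
  change HasDerivAt _ (inner ℂ (expVec f)
    (Complex.I • Complex.I • (inner ℂ (ofReal h₁).conjugate g • expVec g -
        creationVec (ofReal h₁) g) +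
      Complex.I • (inner ℂ (ofReal h₂).conjugate g • expVec g + creationVec (ofReal h₂) g))) 0
  simp only [hc, inner_expVec_weylU, hs, inner_smul_left, inner_smul_right, inner_add_right,
    inner_sub_right, inner_expVec, inner_expVec_creationVec, norm_smul, Complex.conj_ofReal]
  generalize inner ℂ f (ofReal h₁) = a
  generalize inner ℂ (ofReal h₁) g = b
  generalize inner ℂ f (ofReal h₂) = c
  generalize inner ℂ (ofReal h₂) g = d
  generalize inner ℂ f g = s
  generalize ‖h₁‖ = n₁
  generalize ‖h₂‖ = n₂
  have hT : HasDerivAt (fun t : ℝ => (t : ℂ)) 1 0 := Complex.ofRealCLM.hasDerivAt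
  have hE : HasDerivAt (fun t : ℝ => s
      - (t : ℂ) * (t : ℂ) * ((n₁ ^ 2 + n₂ ^ 2 : ℝ) : ℂ) / 2
      + (t : ℂ) * (a - b) + (t : ℂ) * (Complex.I * (c + d)))
      ((a - b) + Complex.I * (c + d)) 0 := by
    have h1 := (((((hT.mul hT).mul_const ((n₁ ^ 2 + n₂ ^ 2 : ℝ) : ℂ)).div_const 2).const_sub s).add
      (hT.mul_const (a - b))).add (hT.mul_const (Complex.I * (c + d)))
    refine h1.congr_deriv ?_
    simp
  have h2 := hE.cexp
  refine (h2.congr_deriv ?_).congr_of_eventuallyEq (Filter.Eventually.of_forall fun t => ?_)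
  · simp only [Complex.ofReal_zero, zero_mul, zero_div, sub_zero, add_zero]
    generalize Complex.exp s = e
    linear_combination (a * e - b * e) * Complex.I_sq
  · refine congrArg Complex.exp ?_
    have : ((‖t‖ : ℂ)) ^ 2 = (t : ℂ) ^ 2 := by
      rw [← Complex.ofReal_pow, ← Complex.ofReal_pow, Real.norm_eq_abs, sq_abs]
    push_cast
    linear_combination (-((n₁ : ℂ) ^ 2 + (n₂ : ℂ) ^ 2) / 2) * this

/-- The Weyl commutation relation; in particular `t ↦ U(t h₁, t h₂)` is a one-parameter group. -/
theorem weylU_comp_weylU (h₁ h₂ k₁ k₂ : E) :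
    weylU h₁ h₂ ∘L weylU k₁ k₂ =
      Complex.exp (Complex.I * (inner ℝ h₂ k₁ - inner ℝ h₁ k₂ : ℝ)) •
        weylU (h₁ + k₁) (h₂ + k₂) := by
  have hz : ofReal (h₁ + k₁) + Complex.I • ofReal (h₂ + k₂) =
      (ofReal h₁ + Complex.I • ofReal h₂) + (ofReal k₁ + Complex.I • ofReal k₂) := by
    apply Complexification.ext
    · simp [ofReal]
    · simp [ofReal]
  rw [weylU, weylU, weylU, hz, weyl_comp_weyl]
  congr 2
  rw [inner_def, inner_def]
  apply Complex.ext
  · simp [ofReal, real_inner_comm]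
  · simp [ofReal, real_inner_comm]
    ring

/-- A function on the plane that defines a tempered distribution: it is measurable and becomes
integrable after division by a power of `1 + ‖p‖`. -/
def IsTempered (φ : ℝ × ℝ → ℂ) : Prop :=
  MeasureTheory.AEStronglyMeasurable φ ∧
    ∃ N : ℕ, MeasureTheory.Integrable fun p => φ p / ((1 + ‖p‖) ^ N : ℝ)

/-- The inverse Fourier transform
`(x, y) ↦ (1 / 2π) ∫ g(u, v) exp (-i (u x + v y)) du dv`. -/
def invFourier (g : ℝ × ℝ → ℂ) (p : ℝ × ℝ) : ℂ :=
  (2 * Real.pi : ℂ)⁻¹ *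
    ∫ w : ℝ × ℝ, g w * Complex.exp (-(Complex.I * (w.1 * p.1 + w.2 * p.2)))

/-- The value at the test function `g` of the inverse Fourier transform of the tempered
distribution `φ`. -/
def invFourierPairing (φ g : ℝ × ℝ → ℂ) : ℂ :=
  ∫ p : ℝ × ℝ, φ p * invFourier g p

/-- The integral `∫ g(u, v) (F⁻¹ φ)(u, v) du dv` of a smooth function `g` against the tempered
distribution `F⁻¹ φ` exists and has the value `c`, where the integral is understood as the limit
for `ε → 0` of the pairings of `F⁻¹ φ` with `g(u, v) exp (- ε (u² + v²))`. If `g` is a Schwartz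
function, this is the pairing of `F⁻¹ φ` with `g`; if `F⁻¹ φ` is a function and its product with
`g` is integrable, it is the Lebesgue integral of the product. -/
def HasIntegralAgainst (φ g : ℝ × ℝ → ℂ) (c : ℂ) : Prop :=
  Filter.Tendsto
    (fun ε : ℝ => invFourierPairing φ fun w => g w * Real.exp (-ε * (w.1 ^ 2 + w.2 ^ 2)))
    (nhdsWithin 0 (Set.Ioi 0)) (nhds c)

/-- The bounded operator `M` satisfies the defining relation of `O_h(φ)`,
`⟪ℰ(f), M ℰ(g)⟫ = (1 / 2π) ∫ ⟪ℰ(f), U(u h₁, v h₂) ℰ(g)⟫ (F⁻¹ φ)(u, v) du dv`. -/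
def IsWeylQuantization (h₁ h₂ : E) (φ : ℝ × ℝ → ℂ)
    (M : Fock (Complexification E) →L[ℂ] Fock (Complexification E)) : Prop :=
  IsTempered φ ∧ ∀ f g : Complexification E,
    HasIntegralAgainst φ
      (fun w => inner ℂ (expVec f) (weylU (w.1 • h₁) (w.2 • h₂) (expVec g)))
      (2 * Real.pi * inner ℂ (expVec f) (M (expVec g)))

/-- The domain of the Weyl calculus `O_h`. -/
def weylDomain (h₁ h₂ : E) : Set (ℝ × ℝ → ℂ) :=
  {φ | ∃ M, IsWeylQuantization h₁ h₂ φ M}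

open Classical in
/-- The bounded operator `O_h(φ)`, for `φ` in the domain of `O_h` (and `0` otherwise). -/
def weylOp (h₁ h₂ : E) (φ : ℝ × ℝ → ℂ) :
    Fock (Complexification E) →L[ℂ] Fock (Complexification E) :=
  if h : φ ∈ weylDomain h₁ h₂ then Classical.choose h else 0

theorem IsWeylQuantization.unique {h₁ h₂ : E} {φ : ℝ × ℝ → ℂ}
    {M N : Fock (Complexification E) →L[ℂ] Fock (Complexification E)}
    (hM : IsWeylQuantization h₁ h₂ φ M) (hN : IsWeylQuantization h₁ h₂ φ N) : M = N := by
  refine ext_of_inner_expVec fun f g => ?_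
  have h := tendsto_nhds_unique (hM.2 f g) (hN.2 f g)
  exact mul_left_cancel₀ (by simp [Real.pi_ne_zero]) h

/-- `O_h(φ)` is the only bounded operator that satisfies its defining relation. -/
theorem weylOp_eq_iff {h₁ h₂ : E} {φ : ℝ × ℝ → ℂ} (hφ : φ ∈ weylDomain h₁ h₂)
    (M : Fock (Complexification E) →L[ℂ] Fock (Complexification E)) :
    weylOp h₁ h₂ φ = M ↔ IsWeylQuantization h₁ h₂ φ M := by
  have h : IsWeylQuantization h₁ h₂ φ (weylOp h₁ h₂ φ) := by
    rw [weylOp, dif_pos hφ]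
    exact Classical.choose_spec hφ
  exact ⟨fun hM => hM ▸ h, fun hM => h.unique hM⟩

/-- The translation `(T_{(x₀, y₀)} φ)(x, y) = φ(x + x₀, y + y₀)`. -/
def translate (x₀ y₀ : ℝ) (φ : ℝ × ℝ → ℂ) : ℝ × ℝ → ℂ :=
  fun p => φ (p.1 + x₀, p.2 + y₀)

/-- `φ'` is the derivative of `φ` in the direction `v` in the sense of tempered distributions. -/
def IsWeakDeriv (v : ℝ × ℝ) (φ φ' : ℝ × ℝ → ℂ) : Prop :=
  ∀ g : SchwartzMap (ℝ × ℝ) ℂ, ∫ p, φ p * lineDeriv ℝ g p v = -∫ p, φ' p * g p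

theorem IsTempered.integrable_mul_schwartz {φ : ℝ × ℝ → ℂ} (hφ : IsTempered φ)
    (g : SchwartzMap (ℝ × ℝ) ℂ) : MeasureTheory.Integrable fun p => φ p * g p := by
  obtain ⟨hm, N, hN⟩ := hφ
  have hpos : ∀ p : ℝ × ℝ, (0 : ℝ) < (1 + ‖p‖) ^ N := fun p => by positivity
  obtain ⟨C, hC⟩ : ∃ C, ∀ p, (1 + ‖p‖) ^ N * ‖g p‖ ≤ C := by
    refine ⟨2 ^ N * ((Finset.Iic (N, 0)).sup fun m => SchwartzMap.seminorm ℝ m.1 m.2) g,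
      fun p => ?_⟩
    simpa using SchwartzMap.one_add_le_sup_seminorm_apply (𝕜 := ℝ) (m := (N, 0)) (k := N) (n := 0)
      le_rfl le_rfl g p
  refine (hN.norm.mul_const C).mono' (hm.mul g.continuous.aestronglyMeasurable)
    (Filter.Eventually.of_forall fun p => ?_)
  rw [norm_mul, norm_div, Complex.norm_real, Real.norm_of_nonneg (hpos p).le, div_mul_eq_mul_div,
    le_div_iff₀ (hpos p), mul_assoc, mul_comm ‖g p‖]
  exact mul_le_mul_of_nonneg_left (hC p) (norm_nonneg _)

/-- A classical derivative is a derivative in the sense of tempered distributions. -/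
theorem isWeakDeriv_of_hasLineDerivAt {v : ℝ × ℝ} {φ φ' : ℝ × ℝ → ℂ} (hφ : IsTempered φ)
    (hφ' : IsTempered φ') (h : ∀ p, HasLineDerivAt ℝ φ (φ' p) p v) : IsWeakDeriv v φ φ' := by
  intro g
  have hg : ∀ p, lineDeriv ℝ g p v = (LineDeriv.lineDerivOp v g : SchwartzMap (ℝ × ℝ) ℂ) p :=
    fun p => (SchwartzMap.lineDerivOp_apply v g p).symm
  refine integral_bilinear_hasLineDerivAt_right_eq_neg_left_of_integrable
    (B := ContinuousLinearMap.mul ℝ ℂ) (v := v) (hφ'.integrable_mul_schwartz g) ?_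
    (hφ.integrable_mul_schwartz g) (fun p _ => h p)
    (fun p _ => (g.differentiableAt.lineDifferentiableAt).hasLineDerivAt)
  simp only [hg]
  exact hφ.integrable_mul_schwartz _

end WeylCalculus

end QuantumWiener

end

open QuantumWiener

namespace QuantumWiener

open Filter Topology Metric

/-! Between exponential vectors everything becomes a Gaussian integral. The matrix element of `weylU
(u • h₁) (v • h₂)`, damped by `ε`, is `exp ⟪f, g⟫` times a Gaussian in `(u, v)` whose linear terms
are `α = ⟪f, h₁⟫ - ⟪h₁, g⟫` and `β = ⟪f, h₂⟫ + ⟪h₂, g⟫`. Its inverse Fourier transform is a constant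
times `gaussKernel`, a Schwartz function of `α - i x` and `β - y`. The matrix elements of the
quantization, divided by `exp ⟪f, g⟫`, are therefore limits for `ε → 0` of Gaussian means of `φ`
that depend on `f` and `g` through `α` and `β` alone (`invFourierPairing_weylU`).

For (a), conjugation with a Weyl operator multiplies `weylU (u • h₁) (v • h₂)` by a character of
`(u, v)`, and modulating the inverse Fourier transform translates the function (`weylU_conj_weylU`,
`invFourierPairing_translate`).

For (b), the operator `X` is `a(p) + a⁺(q)` with `p = k₁ + i k₂` and `q` the analogous combination
of the conjugates. Its commutator is the derivative at `t = 0` of the normalized matrix element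
along `f + conj t • p`, `g - t • q`. For each `ε` this derivative falls on `α` and `β`, hence on `x`
and `y`, and passes to `φ` by the weak derivatives (`hasDerivAt_integral_gaussKernel`). The
remaining issue is to exchange it with the limit `ε → 0`, for which no uniform bound is known. All
functions are entire in `t`, and both the means of `φ` and those of its derivatives converge
pointwise, so a Baire argument suffices (`deriv_eq_of_tendsto`). -/

/-! ### Pointwise limits of entire functions -/

/-- Derivatives of entire functions converge where the functions converge boundedly near the
point. -/
theorem tendsto_deriv_of_bounded {F : ℕ → ℂ → ℂ} {G : ℂ → ℂ} {t : ℂ} {r N : ℝ} (hr : 0 < r)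
    (hF : ∀ n, Differentiable ℂ (F n)) (hG : Differentiable ℂ G)
    (hlim : ∀ t, Tendsto (fun n => F n t) atTop (𝓝 (G t)))
    (hN : ∀ n, ∀ z ∈ closedBall t r, ‖F n z‖ ≤ N) :
    Tendsto (fun n => deriv (F n) t) atTop (𝓝 (deriv G t)) := by
  have hsub : closedBall t r ⊆ Set.univ := Set.subset_univ _
  -- Cauchy's formula turns the derivative into a circle integral of the function itself, to which
  -- dominated convergence applies.
  have hc : ∀ f : ℂ → ℂ, Differentiable ℂ f → deriv f t = Complex.cderiv r f t := fun f hf =>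
    (Complex.cderiv_eq_deriv isOpen_univ hf.differentiableOn hr hsub).symm
  simp only [hc _ (hF _), hc _ hG, Complex.cderiv, circleIntegral]
  refine Tendsto.const_smul ?_ _
  refine intervalIntegral.tendsto_integral_filter_of_dominated_convergence
    (fun _ => |r| * ((r ^ 2)⁻¹ * N)) ?_ ?_ intervalIntegrable_const ?_
  · refine Eventually.of_forall fun n => Continuous.aestronglyMeasurable ?_
    have h1 : ∀ θ : ℝ, (circleMap t r θ - t) ^ 2 ≠ 0 := fun θ => by
      simp [circleMap, hr.ne']
    have h2 := (hF n).continuous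
    simp only [deriv_circleMap, smul_eq_mul]
    fun_prop (disch := exact h1 _)
  · refine Eventually.of_forall fun n => Eventually.of_forall fun θ _ => ?_
    have h1 : ‖circleMap t r θ - t‖ = |r| := by simp [circleMap]
    have h2 := hN n (circleMap t r θ) (circleMap_mem_closedBall t hr.le θ)
    rw [deriv_circleMap, norm_smul, norm_smul, norm_inv, norm_pow, h1, sq_abs, norm_mul]
    simp only [norm_circleMap_zero, Complex.norm_I, mul_one]
    gcongr
  · refine Eventually.of_forall fun θ _ => ?_
    exact ((hlim _).const_smul _).const_smul _

/-- If entire functions and their derivatives converge pointwise, to an entire function and to a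
continuous function, then the second limit is the derivative of the first. No bounds are needed:
by Baire's theorem the functions are locally bounded on a dense open set. -/
theorem deriv_eq_of_tendsto {F : ℕ → ℂ → ℂ} {G H : ℂ → ℂ}
    (hF : ∀ n, Differentiable ℂ (F n)) (hG : Differentiable ℂ G) (hH : Continuous H)
    (hlim : ∀ t, Tendsto (fun n => F n t) atTop (𝓝 (G t)))
    (hlim' : ∀ t, Tendsto (fun n => deriv (F n) t) atTop (𝓝 (H t))) :
    deriv G = H := by
  have hclosed : IsClosed {t | deriv G t = H t} :=
    isClosed_eq (hG.contDiff.continuous_deriv le_rfl) hH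
  -- `A N` collects the points where the whole sequence is bounded by `N`. These sets cover the
  -- plane because convergent sequences are bounded.
  let A : ℕ → Set ℂ := fun N => ⋂ n, {t | ‖F n t‖ ≤ N}
  have hA : ∀ N, IsClosed (A N) := fun N =>
    isClosed_iInter fun n => isClosed_le (hF n).continuous.norm continuous_const
  have hU : ⋃ N, A N = Set.univ := by
    refine Set.eq_univ_of_forall fun t => ?_
    obtain ⟨C, hC⟩ := (hlim t).norm.bddAbove_range
    obtain ⟨N, hN⟩ := exists_nat_ge C
    exact Set.mem_iUnion.2 ⟨N, Set.mem_iInter.2 fun n => (hC ⟨n, rfl⟩).trans hN⟩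
  have hd := dense_iUnion_interior_of_closed hA hU
  have hsub : (⋃ N, interior (A N)) ⊆ {t | deriv G t = H t} := by
    intro t ht
    obtain ⟨N, hN⟩ := Set.mem_iUnion.1 ht
    obtain ⟨r, hr, hball⟩ := nhds_basis_closedBall.mem_iff.1 (mem_interior_iff_mem_nhds.1 hN)
    exact tendsto_nhds_unique (tendsto_deriv_of_bounded hr hF hG hlim
      fun n z hz => Set.mem_iInter.1 (hball hz) n) (hlim' t)
  funext t
  exact hclosed.closure_subset_iff.2 hsub (hd t)

/-- A continuous function of a complex variable is entire if it becomes entire under a family of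
functionals that separates the points. -/
theorem differentiable_of_forall_clm {H ι : Type*} [NormedAddCommGroup H] [NormedSpace ℂ H]
    [CompleteSpace H] {Φ : ℂ → H} (hΦ : Continuous Φ) (Λ : ι → H →L[ℂ] ℂ)
    (hsep : ∀ x y, (∀ i, Λ i x = Λ i y) → x = y)
    (hd : ∀ i, Differentiable ℂ fun t => Λ i (Φ t)) : Differentiable ℂ Φ := by
  intro t
  -- The Cauchy integral of a merely continuous function is analytic inside the circle. It agrees
  -- with `Φ` there because each `Λ i` commutes with the integral and satisfies Cauchy's formula.
  have hps := (hasFPowerSeriesOn_cauchy_integral (f := Φ) (c := t) (R := 1)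
    hΦ.continuousOn.circleIntegrable' one_pos).analyticAt.differentiableAt
  refine hps.congr_of_eventuallyEq ?_
  filter_upwards [ball_mem_nhds t one_pos] with w hw
  refine hsep _ _ fun i => ?_
  have hcauchy :=
    Complex.two_pi_I_inv_smul_circleIntegral_sub_inv_smul_of_differentiable_on_off_countable
    (s := ∅) (by simp) hw (hd i).continuous.continuousOn fun z _ => hd i z
  rw [map_smul, ← hcauchy]
  congr 1
  have hint : CircleIntegrable (fun z => (z - w)⁻¹ • Φ z) t 1 := by
    refine ContinuousOn.circleIntegrable zero_le_one (ContinuousOn.smul ?_ hΦ.continuousOn)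
    refine (continuousOn_id.sub continuousOn_const).inv₀ fun z hz h0 => ?_
    have : z = w := sub_eq_zero.1 h0
    subst this
    exact absurd (mem_sphere.1 hz) (mem_ball.1 hw).ne
  have hint' := hint.out
  simp only [circleIntegral]
  rw [NNReal.coe_one, ← ContinuousLinearMap.intervalIntegral_comp_comm (Λ i) hint']
  simp only [map_smul]

/-! ### Exponential vectors depend analytically on the vector -/

section Fock

variable {K : Type*} [NormedAddCommGroup K] [InnerProductSpace ℂ K]

theorem eq_of_inner_expVec {x y : Fock K}
    (h : ∀ f : K, inner ℂ (expVec f) x = inner ℂ (expVec f) y) : x = y := by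
  rw [← sub_eq_zero]
  refine eq_zero_of_inner_expVec fun f => ?_
  rw [← inner_conj_symm, inner_sub_right, h f, sub_self, map_zero]

/-- The squared distance of two exponential vectors is a combination of exponentials of inner
products, which are continuous and cancel when the vectors coincide. -/
theorem continuous_expVec : Continuous (expVec : K → Fock K) := by
  rw [continuous_iff_continuousAt]
  intro g
  rw [ContinuousAt, tendsto_iff_norm_sub_tendsto_zero]
  have h : ∀ f : K, ‖expVec f - expVec g‖ = √(RCLike.re (Complex.exp (inner ℂ f f) -
      Complex.exp (inner ℂ f g) - (Complex.exp (inner ℂ g f) - Complex.exp (inner ℂ g g)))) := by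
    intro f
    rw [norm_eq_sqrt_re_inner (𝕜 := ℂ)]
    simp only [inner_sub_left, inner_sub_right, inner_expVec]
    congr 2
    ring
  have hc : Continuous fun f : K => √(RCLike.re (Complex.exp (inner ℂ f f) -
      Complex.exp (inner ℂ f g) - (Complex.exp (inner ℂ g f) - Complex.exp (inner ℂ g g)))) := by
    refine Real.continuous_sqrt.comp (RCLike.continuous_re.comp ?_)
    fun_prop
  simp only [h]
  simpa using hc.tendsto g

/-- Pairing with an exponential vector gives an explicit entire function. Only these functionals are
accessible, so norm differentiability comes from continuity through `differentiable_of_forall_clm`,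
and the derivative is then identified by its pairings. -/
theorem hasDerivAt_expVec (g q : K) (t : ℂ) :
    HasDerivAt (fun t : ℂ => expVec (g + t • q)) (creationVec q (g + t • q)) t := by
  have hd : ∀ f, ∀ t, HasDerivAt (fun t : ℂ => innerSL ℂ (expVec f) (expVec (g + t • q)))
      (inner ℂ (expVec f) (creationVec q (g + t • q))) t := by
    intro f t
    simp only [innerSL_apply_apply, inner_expVec, inner_expVec_creationVec, inner_add_right,
      inner_smul_right]
    have h := (((hasDerivAt_id t).mul_const (inner ℂ f q)).const_add (inner ℂ f g)).cexp
    refine h.congr_deriv ?_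
    simp only [id_eq]
    ring
  have hdiff : Differentiable ℂ fun t : ℂ => expVec (g + t • q) := by
    refine differentiable_of_forall_clm (continuous_expVec.comp (by fun_prop))
      (fun f : K => innerSL ℂ (expVec f)) (fun x y h => eq_of_inner_expVec h)
      fun f t => (hd f t).differentiableAt
  refine (hdiff t).hasDerivAt.congr_deriv (eq_of_inner_expVec fun f => ?_)
  exact ((innerSL ℂ (expVec f)).hasFDerivAt.comp_hasDerivAt t (hdiff t).hasDerivAt).unique (hd f t)

/-- Matrix elements between exponential vectors are analytic along complex lines that are
conjugate linear in the first argument. -/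
theorem hasDerivAt_inner_expVec (M : Fock K →L[ℂ] Fock K) (f g p q : K) (t : ℂ) :
    HasDerivAt (fun t : ℂ => inner ℂ (expVec (f + conj t • p)) (M (expVec (g + t • q))))
      (inner ℂ (creationVec p (f + conj t • p)) (M (expVec (g + t • q))) +
        inner ℂ (expVec (f + conj t • p)) (M (creationVec q (g + t • q)))) t := by
  -- The conjugation of `t` and the conjugate linearity of `innerSL` cancel, so the first slot is
  -- complex differentiable too. This is seen on difference quotients.
  have h1 : HasDerivAt (fun t : ℂ => innerSL ℂ (expVec (f + conj t • p)))
      (innerSL ℂ (creationVec p (f + conj t • p))) t := by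
    have h := hasDerivAt_expVec f p (conj t)
    rw [hasDerivAt_iff_tendsto_slope] at h ⊢
    have hc : Tendsto (fun s : ℂ => conj s) (𝓝[≠] t) (𝓝[≠] (conj t)) := by
      refine tendsto_nhdsWithin_iff.2
        ⟨(Complex.continuous_conj.tendsto t).mono_left nhdsWithin_le_nhds, ?_⟩
      filter_upwards [self_mem_nhdsWithin] with s hs
      exact fun h => hs ((starRingEnd ℂ).injective h)
    refine (((innerSL ℂ).continuous.tendsto _).comp (h.comp hc)).congr fun s => ?_
    simp only [Function.comp_apply, slope_def_module]
    rw [map_smulₛₗ, map_sub, map_inv₀, map_sub, Complex.conj_conj, Complex.conj_conj]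
  have h2 := M.hasFDerivAt.comp_hasDerivAt t (hasDerivAt_expVec g q t)
  exact h1.clm_apply h2

end Fock

open MeasureTheory

/-! ### Gaussians as Schwartz functions -/

/-- The exponential is its own derivative, and the multiplication map by which `fderiv` encodes this
has norm at most one. -/
theorem norm_iteratedFDeriv_cexp_le (n : ℕ) (z : ℂ) :
    ‖iteratedFDeriv ℝ n Complex.exp z‖ ≤ ‖Complex.exp z‖ := by
  induction n with
  | zero => simp
  | succ n ih =>
    let L : ℂ →L[ℝ] ℂ →L[ℝ] ℂ := ContinuousLinearMap.mul ℝ ℂ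
    have h : fderiv ℝ Complex.exp = L ∘ Complex.exp := by
      funext w
      rw [((Complex.hasDerivAt_exp w).hasFDerivAt.restrictScalars ℝ).fderiv]
      ext
      simp [L, mul_comm]
    rw [← norm_iteratedFDeriv_fderiv, h]
    refine (L.norm_iteratedFDeriv_comp_left (N := n) (Complex.contDiff_exp.contDiffAt)
      le_rfl).trans ?_
    have hL : ‖L‖ ≤ 1 := ContinuousLinearMap.opNorm_mul_le ℝ ℂ
    exact (mul_le_of_le_one_left (norm_nonneg _) hL).trans ih

/-- The exponential of a function of temperate growth is a Schwartz function if it decays faster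
than the powers of the norm. -/
noncomputable def schwartzExp {V : Type*} [NormedAddCommGroup V] [NormedSpace ℝ V] (q : V → ℂ)
    (hq : q.HasTemperateGrowth)
    (hdecay : ∀ k : ℕ, ∃ C : ℝ, ∀ x, (1 + ‖x‖) ^ k * ‖Complex.exp (q x)‖ ≤ C) :
    SchwartzMap V ℂ where
  toFun x := Complex.exp (q x)
  smooth' := Complex.contDiff_exp.comp hq.1
  decay' k n := by
    obtain ⟨m, D, hD, hb⟩ := hq.norm_iteratedFDeriv_le_uniform n
    -- The chain rule for the `n`-th derivative costs up to `n` factors of growth `(1 + ‖x‖) ^ m`,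
    -- which the decay of the exponential has to absorb.
    obtain ⟨C, hC⟩ := hdecay (k + m * n)
    refine ⟨n.factorial * (1 + D) ^ n * C, fun x => ?_⟩
    have hx : 1 ≤ 1 + ‖x‖ := le_add_of_nonneg_right (norm_nonneg x)
    have h1 := norm_iteratedFDeriv_comp_le (n := n) (N := n) (Complex.contDiff_exp (𝕜 := ℝ))
      (hq.1.of_le (by exact_mod_cast le_top)) le_rfl x (C := ‖Complex.exp (q x)‖)
      (D := (1 + D) * (1 + ‖x‖) ^ m) (fun i _ => norm_iteratedFDeriv_cexp_le i (q x))
      (fun i hi hin => by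
        refine (hb i hin x).trans ?_
        -- With `1 + D` in place of `D` the base is at least one, hence bounded by each of its
        -- positive powers.
        have h2 : 1 ≤ (1 + D) * (1 + ‖x‖) ^ m :=
          one_le_mul_of_one_le_of_one_le (by linarith) (one_le_pow₀ hx)
        refine le_trans ?_ (le_self_pow₀ h2 (by omega))
        gcongr
        linarith)
    calc ‖x‖ ^ k * ‖iteratedFDeriv ℝ n (fun x => Complex.exp (q x)) x‖
        ≤ (1 + ‖x‖) ^ k * (n.factorial * ‖Complex.exp (q x)‖ *
            ((1 + D) * (1 + ‖x‖) ^ m) ^ n) := by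
          gcongr
          · linarith
          · exact h1
      _ = n.factorial * (1 + D) ^ n * ((1 + ‖x‖) ^ (k + m * n) * ‖Complex.exp (q x)‖) := by
          rw [pow_add, pow_mul, mul_pow]
          ring
      _ ≤ n.factorial * (1 + D) ^ n * C := by
          gcongr
          exact hC x

/-- Bound `1 + r` by `exp r` and complete the square in `N r - δ r²`. -/
theorem one_add_pow_mul_exp_neg_sq_le (N : ℕ) {δ : ℝ} (hδ : 0 < δ) {r : ℝ} (hr : 0 ≤ r) :
    (1 + r) ^ N * Real.exp (-(δ * r ^ 2)) ≤ Real.exp (N ^ 2 / (4 * δ)) := by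
  calc (1 + r) ^ N * Real.exp (-(δ * r ^ 2))
      ≤ Real.exp r ^ N * Real.exp (-(δ * r ^ 2)) := by
        gcongr
        linarith [Real.add_one_le_exp r]
    _ = Real.exp (N * r - δ * r ^ 2) := by
        rw [← Real.exp_nat_mul, ← Real.exp_add, sub_eq_add_neg]
    _ ≤ _ := by
        refine Real.exp_le_exp.2 ?_
        rw [le_div_iff₀ (by positivity)]
        nlinarith [sq_nonneg (2 * δ * r - N)]

/-- The Gaussian that is up to a factor the inverse Fourier transform of
`exp (- (A u² + B v²) / 2 + α u + i β v)`. -/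
noncomputable def gaussKernel (A B : ℝ) (α β : ℂ) (p : ℝ × ℝ) : ℂ :=
  Complex.exp ((α - Complex.I * p.1) ^ 2 / (2 * A) - (β - p.2) ^ 2 / (2 * B))

/-- The shifts `Im α` and `Re β` cost at most half of the quadratic decay in `x` and `y`. Uniformity
for bounded `α` and `β` is what domination under the integral sign requires later. -/
theorem exists_gaussKernel_le {A B : ℝ} (hA : 0 < A) (hB : 0 < B) (R : ℝ) (N : ℕ) :
    ∃ C : ℝ, ∀ α β : ℂ, ‖α‖ ≤ R → ‖β‖ ≤ R → ∀ p : ℝ × ℝ,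
      (1 + ‖p‖) ^ N * ‖gaussKernel A B α β p‖ ≤ C := by
  let δ : ℝ := min (1 / (4 * A)) (1 / (4 * B))
  have hδ : 0 < δ := lt_min (by positivity) (by positivity)
  refine ⟨Real.exp (R ^ 2 / A + R ^ 2 / B) * Real.exp (N ^ 2 / (4 * δ)),
    fun α β hα hβ p => ?_⟩
  have hsq : ∀ z : ℂ, ‖z‖ ≤ R → z.re ^ 2 + z.im ^ 2 ≤ R ^ 2 := fun z hz => by
    have := Complex.sq_norm z
    rw [Complex.normSq_apply] at this
    nlinarith [norm_nonneg z]
  have h1 : ‖gaussKernel A B α β p‖ ≤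
      Real.exp (R ^ 2 / A + R ^ 2 / B) * Real.exp (-(δ * ‖p‖ ^ 2)) := by
    rw [gaussKernel, Complex.norm_exp, ← Real.exp_add]
    refine Real.exp_le_exp.2 ?_
    have e1 : ((α - Complex.I * p.1) ^ 2 / (2 * A) - (β - p.2) ^ 2 / (2 * B)).re =
        (α.re ^ 2 - (α.im - p.1) ^ 2) / (2 * A) - ((β.re - p.2) ^ 2 - β.im ^ 2) / (2 * B) := by
      have : ((2 : ℂ) * A) = ((2 * A : ℝ) : ℂ) := by push_cast; rfl
      rw [this]
      have : ((2 : ℂ) * B) = ((2 * B : ℝ) : ℂ) := by push_cast; rfl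
      rw [this, Complex.sub_re, Complex.div_ofReal_re, Complex.div_ofReal_re]
      simp [pow_two]
    have e2 : (α.re ^ 2 - (α.im - p.1) ^ 2) / (2 * A) ≤ R ^ 2 / A - 1 / (4 * A) * p.1 ^ 2 := by
      have := hsq α hα
      have h : R ^ 2 / A - 1 / (4 * A) * p.1 ^ 2 = (4 * R ^ 2 - p.1 ^ 2) / 2 / (2 * A) := by
        field_simp
        ring
      rw [h]
      gcongr
      nlinarith [sq_nonneg (p.1 - 2 * α.im)]
    have e3 : -(((β.re - p.2) ^ 2 - β.im ^ 2) / (2 * B)) ≤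
        R ^ 2 / B - 1 / (4 * B) * p.2 ^ 2 := by
      have := hsq β hβ
      have h : R ^ 2 / B - 1 / (4 * B) * p.2 ^ 2 = (4 * R ^ 2 - p.2 ^ 2) / 2 / (2 * B) := by
        field_simp
        ring
      rw [h, ← neg_div]
      gcongr
      nlinarith [sq_nonneg (p.2 - 2 * β.re)]
    have e4 : δ * p.1 ^ 2 ≤ 1 / (4 * A) * p.1 ^ 2 := by
      gcongr
      exact min_le_left _ _
    have e5 : δ * p.2 ^ 2 ≤ 1 / (4 * B) * p.2 ^ 2 := by
      gcongr
      exact min_le_right _ _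
    -- The product carries the maximum norm, so this is an inequality.
    have e6 : ‖p‖ ^ 2 ≤ p.1 ^ 2 + p.2 ^ 2 := by
      rw [Prod.norm_def]
      rcases max_choice ‖p.1‖ ‖p.2‖ with h | h <;> rw [h, Real.norm_eq_abs, sq_abs] <;>
        nlinarith [sq_nonneg p.1, sq_nonneg p.2]
    have e7 : δ * ‖p‖ ^ 2 ≤ δ * (p.1 ^ 2 + p.2 ^ 2) := by gcongr
    rw [e1]
    linarith
  calc (1 + ‖p‖) ^ N * ‖gaussKernel A B α β p‖
      ≤ (1 + ‖p‖) ^ N * (Real.exp (R ^ 2 / A + R ^ 2 / B) * Real.exp (-(δ * ‖p‖ ^ 2))) := by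
        gcongr
    _ = Real.exp (R ^ 2 / A + R ^ 2 / B) * ((1 + ‖p‖) ^ N * Real.exp (-(δ * ‖p‖ ^ 2))) := by ring
    _ ≤ _ := by
        gcongr
        exact one_add_pow_mul_exp_neg_sq_le N hδ (norm_nonneg p)

/-- The Gaussian as a Schwartz function. -/
noncomputable def gaussSchwartz {A B : ℝ} (hA : 0 < A) (hB : 0 < B) (α β : ℂ) :
    SchwartzMap (ℝ × ℝ) ℂ :=
  schwartzExp (fun p => (α - Complex.I * p.1) ^ 2 / (2 * A) - (β - p.2) ^ 2 / (2 * B))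
    (by
      have h1 : Function.HasTemperateGrowth fun p : ℝ × ℝ => (p.1 : ℂ) :=
        (Complex.ofRealCLM.comp (ContinuousLinearMap.fst ℝ ℝ ℝ)).hasTemperateGrowth
      have h2 : Function.HasTemperateGrowth fun p : ℝ × ℝ => (p.2 : ℂ) :=
        (Complex.ofRealCLM.comp (ContinuousLinearMap.snd ℝ ℝ ℝ)).hasTemperateGrowth
      simp only [pow_two, div_eq_mul_inv]
      fun_prop)
    fun N => by
      obtain ⟨C, hC⟩ := exists_gaussKernel_le hA hB (max ‖α‖ ‖β‖) N
      exact ⟨C, hC α β (le_max_left _ _) (le_max_right _ _)⟩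

theorem gaussSchwartz_apply {A B : ℝ} (hA : 0 < A) (hB : 0 < B) (α β : ℂ) (p : ℝ × ℝ) :
    gaussSchwartz hA hB α β p = gaussKernel A B α β p := rfl

theorem lineDeriv_gaussSchwartz_fst {A B : ℝ} (hA : 0 < A) (hB : 0 < B) (α β : ℂ) (p : ℝ × ℝ) :
    lineDeriv ℝ (gaussSchwartz hA hB α β) p (1, 0) =
      -(Complex.I * (α - Complex.I * p.1) / A) * gaussKernel A B α β p := by
  refine HasLineDerivAt.lineDeriv ?_
  have hT : HasDerivAt (fun t : ℝ => ((p.1 + t : ℝ) : ℂ)) 1 0 :=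
    ((hasDerivAt_id (0 : ℝ)).const_add p.1).ofReal_comp
  have h := ((((hT.const_mul Complex.I).const_sub α).pow 2).div_const (2 * A : ℂ)).sub_const
    ((β - p.2) ^ 2 / (2 * B)) |>.cexp
  rw [HasLineDerivAt]
  refine (h.congr_deriv ?_).congr_of_eventuallyEq (Eventually.of_forall fun t => ?_)
  · rw [gaussKernel]
    have : (A : ℂ) ≠ 0 := by exact_mod_cast hA.ne'
    simp
    field_simp
  · simp [gaussSchwartz_apply, gaussKernel]

theorem lineDeriv_gaussSchwartz_snd {A B : ℝ} (hA : 0 < A) (hB : 0 < B) (α β : ℂ) (p : ℝ × ℝ) :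
    lineDeriv ℝ (gaussSchwartz hA hB α β) p (0, 1) =
      (β - p.2) / B * gaussKernel A B α β p := by
  refine HasLineDerivAt.lineDeriv ?_
  have hT : HasDerivAt (fun t : ℝ => ((p.2 + t : ℝ) : ℂ)) 1 0 :=
    ((hasDerivAt_id (0 : ℝ)).const_add p.2).ofReal_comp
  have h := (((hT.const_sub β).pow 2).div_const (2 * B : ℂ)).const_sub
    ((α - Complex.I * p.1) ^ 2 / (2 * A)) |>.cexp
  rw [HasLineDerivAt]
  refine (h.congr_deriv ?_).congr_of_eventuallyEq (Eventually.of_forall fun t => ?_)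
  · rw [gaussKernel]
    have : (B : ℂ) ≠ 0 := by exact_mod_cast hB.ne'
    simp
    field_simp
  · simp [gaussSchwartz_apply, gaussKernel]

/-- The integrand separates into one-dimensional quadratic exponentials. The constant `s` is put
into the first factor, and the second gets the constant `0`. -/
theorem invFourier_gauss {A B : ℝ} (hA : 0 < A) (hB : 0 < B) (s α β : ℂ) (p : ℝ × ℝ) :
    invFourier (fun w => Complex.exp (s - (A * w.1 ^ 2 + B * w.2 ^ 2) / 2 + w.1 * α +
      Complex.I * (w.2 * β))) p =
    (2 * Real.pi : ℂ)⁻¹ * ((Real.pi / (A / 2 : ℂ)) ^ (1 / 2 : ℂ) *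
      (Real.pi / (B / 2 : ℂ)) ^ (1 / 2 : ℂ)) * Complex.exp s * gaussKernel A B α β p := by
  have hA' : (A : ℂ) ≠ 0 := by exact_mod_cast hA.ne'
  have hB' : (B : ℂ) ≠ 0 := by exact_mod_cast hB.ne'
  have hbA : (-(A / 2 : ℂ)).re < 0 := by simpa using hA
  have hbB : (-(B / 2 : ℂ)).re < 0 := by simpa using hB
  have h : ∀ w : ℝ × ℝ, Complex.exp (s - (A * w.1 ^ 2 + B * w.2 ^ 2) / 2 + w.1 * α +
      Complex.I * (w.2 * β)) * Complex.exp (-(Complex.I * (w.1 * p.1 + w.2 * p.2))) =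
      Complex.exp (-(A / 2) * w.1 ^ 2 + (α - Complex.I * p.1) * w.1 + s) *
      Complex.exp (-(B / 2) * w.2 ^ 2 + Complex.I * (β - p.2) * w.2 + 0) := by
    intro w
    rw [← Complex.exp_add, ← Complex.exp_add]
    congr 1
    ring
  rw [invFourier]
  simp only [h]
  rw [Measure.volume_eq_prod, integral_prod_mul
    (f := fun u : ℝ => Complex.exp (-(A / 2) * u ^ 2 + (α - Complex.I * p.1) * u + s))
    (g := fun v : ℝ => Complex.exp (-(B / 2) * v ^ 2 + Complex.I * (β - p.2) * v + 0)),
    integral_cexp_quadratic hbA, integral_cexp_quadratic hbB, neg_neg, neg_neg]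
  have e : Complex.exp (s - (α - Complex.I * p.1) ^ 2 / (4 * -(A / 2))) *
      Complex.exp (0 - (Complex.I * (β - p.2)) ^ 2 / (4 * -(B / 2))) =
      Complex.exp s * gaussKernel A B α β p := by
    rw [gaussKernel, ← Complex.exp_add, ← Complex.exp_add, mul_pow Complex.I, Complex.I_sq]
    congr 1
    field_simp
    ring
  linear_combination (2 * Real.pi : ℂ)⁻¹ * ((Real.pi / (A / 2 : ℂ)) ^ (1 / 2 : ℂ) *
      (Real.pi / (B / 2 : ℂ)) ^ (1 / 2 : ℂ)) * e

/-- Gaussian means of a tempered function are entire along complex lines, and their derivatives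
are Gaussian means of the derivatives of the function. -/
theorem hasDerivAt_integral_gaussKernel {A B : ℝ} (hA : 0 < A) (hB : 0 < B)
    {φ φx φy : ℝ × ℝ → ℂ} (hφ : IsTempered φ)
    (hx : IsWeakDeriv (1, 0) φ φx) (hy : IsWeakDeriv (0, 1) φ φy) (α β α' β' t : ℂ) :
    HasDerivAt (fun t => ∫ p, φ p * gaussKernel A B (α + t * α') (β + t * β') p)
      (-(Complex.I * α' * ∫ p, φx p * gaussKernel A B (α + t * α') (β + t * β') p) +
        β' * ∫ p, φy p * gaussKernel A B (α + t * α') (β + t * β') p) t := by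
  have hA' : (A : ℂ) ≠ 0 := by exact_mod_cast hA.ne'
  have hB' : (B : ℂ) ≠ 0 := by exact_mod_cast hB.ne'
  let D : ℂ → ℝ × ℝ → ℂ := fun t p =>
    (α' * (α + t * α' - Complex.I * p.1) / A - β' * (β + t * β' - p.2) / B) *
      gaussKernel A B (α + t * α') (β + t * β') p
  have hD : ∀ t p, HasDerivAt (fun t => gaussKernel A B (α + t * α') (β + t * β') p)
      (D t p) t := by
    intro t p
    have h1 : HasDerivAt (fun t => α + t * α' - Complex.I * p.1) α' t := by
      simpa using (((hasDerivAt_id t).mul_const α').const_add α).sub_const (Complex.I * p.1)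
    have h2 : HasDerivAt (fun t => β + t * β' - p.2) β' t := by
      simpa using (((hasDerivAt_id t).mul_const β').const_add β).sub_const (p.2 : ℂ)
    have h := (((h1.pow 2).div_const (2 * A : ℂ)).sub ((h2.pow 2).div_const (2 * B : ℂ))).cexp
    refine h.congr_deriv ?_
    simp only [D, gaussKernel, Pi.sub_apply, Pi.pow_apply]
    push_cast
    field_simp
  -- The kernel involves only `α - i x` and `β - y`, so differentiating in `α` amounts to `i ∂/∂x`
  -- and in `β` to `-∂/∂y`. This allows the weak derivatives of `φ` to enter.
  have hDcomb : ∀ p, D t p =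
      Complex.I * α' * lineDeriv ℝ (gaussSchwartz hA hB (α + t * α') (β + t * β')) p (1, 0) -
      β' * lineDeriv ℝ (gaussSchwartz hA hB (α + t * α') (β + t * β')) p (0, 1) := by
    intro p
    rw [lineDeriv_gaussSchwartz_fst, lineDeriv_gaussSchwartz_snd]
    simp only [D]
    linear_combination (α' * (α + t * α' - Complex.I * p.1) / A *
      gaussKernel A B (α + t * α') (β + t * β') p) * Complex.I_sq
  obtain ⟨hm, N, hN⟩ := hφ
  have hmeas : ∀ t, AEStronglyMeasurable
      (fun p => φ p * gaussKernel A B (α + t * α') (β + t * β') p) := fun t =>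
    hm.mul (gaussSchwartz hA hB (α + t * α') (β + t * β')).continuous.aestronglyMeasurable
  let R : ℝ := max (‖α‖ + (‖t‖ + 1) * ‖α'‖) (‖β‖ + (‖t‖ + 1) * ‖β'‖)
  have hR : ∀ s ∈ Metric.ball t 1, ‖α + s * α'‖ ≤ R ∧ ‖β + s * β'‖ ≤ R := by
    intro s hs
    have h1 : ‖s‖ ≤ ‖t‖ + 1 := by
      have := norm_sub_norm_le s t
      rw [mem_ball_iff_norm] at hs
      linarith
    constructor
    · refine (norm_add_le _ _).trans (le_trans ?_ (le_max_left _ _))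
      rw [norm_mul]
      gcongr
    · refine (norm_add_le _ _).trans (le_trans ?_ (le_max_right _ _))
      rw [norm_mul]
      gcongr
  -- One power beyond `N` compensates the linear factor that differentiation brings down. `R` bounds
  -- both parameters on the unit disc around `t`.
  obtain ⟨C, hC⟩ := exists_gaussKernel_le hA hB R (N + 1)
  let c : ℝ := ‖α'‖ * (R + 1) / A + ‖β'‖ * (R + 1) / B
  have key : HasDerivAt (fun t => ∫ p, φ p * gaussKernel A B (α + t * α') (β + t * β') p)
      (∫ p, φ p * D t p) t := by
    refine (hasDerivAt_integral_of_dominated_loc_of_deriv_le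
      (F' := fun s p => φ p * D s p) (bound := fun p => ‖φ p / ((1 + ‖p‖) ^ N : ℝ)‖ * (c * C))
      (Metric.ball_mem_nhds t one_pos)
      (Eventually.of_forall hmeas)
      (IsTempered.integrable_mul_schwartz ⟨hm, N, hN⟩
        (gaussSchwartz hA hB (α + t * α') (β + t * β')))
      ?_ ?_ (hN.norm.mul_const _) ?_).2
    · refine hm.mul (Continuous.aestronglyMeasurable ?_)
      have := (gaussSchwartz hA hB (α + t * α') (β + t * β')).continuous
      simp only [D]
      refine Continuous.mul ?_ this
      fun_prop
    · refine Eventually.of_forall fun p s hs => ?_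
      obtain ⟨h1, h2⟩ := hR s hs
      have hpos : (0 : ℝ) < (1 + ‖p‖) ^ N := by positivity
      have hR0 : 0 ≤ R := (norm_nonneg _).trans h1
      have hp1 : ‖(p.1 : ℂ)‖ ≤ ‖p‖ := by
        rw [Complex.norm_real]
        exact norm_fst_le p
      have hp2 : ‖(p.2 : ℂ)‖ ≤ ‖p‖ := by
        rw [Complex.norm_real]
        exact norm_snd_le p
      have b1 : ‖α + s * α' - Complex.I * p.1‖ ≤ (R + 1) * (1 + ‖p‖) := by
        refine (norm_sub_le _ _).trans ?_
        rw [norm_mul, Complex.norm_I, one_mul]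
        nlinarith [norm_nonneg p]
      have b2 : ‖β + s * β' - p.2‖ ≤ (R + 1) * (1 + ‖p‖) := by
        refine (norm_sub_le _ _).trans ?_
        nlinarith [norm_nonneg p]
      have b3 : ‖D s p‖ ≤ c * (1 + ‖p‖) * ‖gaussKernel A B (α + s * α') (β + s * β') p‖ := by
        simp only [D]
        rw [norm_mul]
        gcongr
        refine (norm_sub_le _ _).trans ?_
        rw [norm_div, norm_div, norm_mul, norm_mul, Complex.norm_real, Complex.norm_real,
          Real.norm_of_nonneg hA.le, Real.norm_of_nonneg hB.le]
        calc _ ≤ ‖α'‖ * ((R + 1) * (1 + ‖p‖)) / A + ‖β'‖ * ((R + 1) * (1 + ‖p‖)) / B := by gcongr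
          _ = c * (1 + ‖p‖) := by simp only [c]; ring
      have b4 := hC _ _ h1 h2 p
      have hc : 0 ≤ c := by positivity
      rw [norm_mul, norm_div, Complex.norm_real, Real.norm_of_nonneg hpos.le, div_mul_eq_mul_div,
        le_div_iff₀ hpos, mul_assoc]
      refine mul_le_mul_of_nonneg_left ?_ (norm_nonneg _)
      calc ‖D s p‖ * (1 + ‖p‖) ^ N
          ≤ c * (1 + ‖p‖) * ‖gaussKernel A B (α + s * α') (β + s * β') p‖ * (1 + ‖p‖) ^ N := by
            gcongr
        _ = c * ((1 + ‖p‖) ^ (N + 1) * ‖gaussKernel A B (α + s * α') (β + s * β') p‖) := by ring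
        _ ≤ c * C := by gcongr
    · exact Eventually.of_forall fun p s _ => (hD s p).const_mul _
  refine key.congr_deriv ?_
  have hint : ∀ v, Integrable fun p =>
      φ p * lineDeriv ℝ (gaussSchwartz hA hB (α + t * α') (β + t * β')) p v := fun v => by
    simpa only [SchwartzMap.lineDerivOp_apply] using
      IsTempered.integrable_mul_schwartz ⟨hm, N, hN⟩
        (LineDeriv.lineDerivOp v (gaussSchwartz hA hB (α + t * α') (β + t * β')))
  have hsplit : ∀ p, φ p * D t p =
      Complex.I * α' * (φ p *
        lineDeriv ℝ (gaussSchwartz hA hB (α + t * α') (β + t * β')) p (1, 0)) -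
      β' * (φ p * lineDeriv ℝ (gaussSchwartz hA hB (α + t * α') (β + t * β')) p (0, 1)) := by
    intro p
    rw [hDcomb]
    ring
  simp only [hsplit]
  rw [integral_sub ((hint _).const_mul _) ((hint _).const_mul _), integral_const_mul,
    integral_const_mul, hx, hy]
  simp only [gaussSchwartz_apply]
  ring

open Complexification

/-! ### The pairing of the Weyl operators with a tempered function -/

section WeylCalculus

variable {E : Type*} [NormedAddCommGroup E] [InnerProductSpace ℝ E]

theorem inner_smul_ofReal_left (t : ℝ) (h : E) (g : Complexification E) :
    inner ℂ (ofReal (t • h)) g = t * inner ℂ (ofReal h) g := by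
  rw [inner_def, inner_def]
  apply Complex.ext
  · simp [ofReal, real_inner_smul_left]
  · simp [ofReal, real_inner_smul_left]

theorem inner_smul_ofReal_right (t : ℝ) (h : E) (f : Complexification E) :
    inner ℂ f (ofReal (t • h)) = t * inner ℂ f (ofReal h) := by
  rw [inner_def, inner_def]
  apply Complex.ext
  · simp [ofReal, real_inner_smul_right]
  · simp [ofReal, real_inner_smul_right]

theorem inner_ofReal_conjugate (h : E) (k : Complexification E) :
    inner ℂ (ofReal h) k.conjugate = inner ℂ k (ofReal h) := by
  rw [inner_def, inner_def]
  apply Complex.ext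
  · simp [ofReal, conjugate, real_inner_comm]
  · simp [ofReal, conjugate, real_inner_comm]

/-- The factor of the Gaussian integral `invFourier_gauss`. -/
noncomputable def gaussConst (A B : ℝ) : ℂ :=
  (2 * Real.pi : ℂ)⁻¹ * ((Real.pi / (A / 2 : ℂ)) ^ (1 / 2 : ℂ) *
    (Real.pi / (B / 2 : ℂ)) ^ (1 / 2 : ℂ))

/-- The damping adds `2 ε` to `‖h₁‖ ^ 2` and `‖h₂‖ ^ 2`, so the Gaussian is nondegenerate even when
a vector vanishes. -/
theorem invFourierPairing_weylU (h₁ h₂ : E) (φ : ℝ × ℝ → ℂ) (f g : Complexification E) {ε : ℝ}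
    (hε : 0 < ε) :
    invFourierPairing φ (fun w => inner ℂ (expVec f) (weylU (w.1 • h₁) (w.2 • h₂) (expVec g)) *
      Real.exp (-ε * (w.1 ^ 2 + w.2 ^ 2))) =
    gaussConst (‖h₁‖ ^ 2 + 2 * ε) (‖h₂‖ ^ 2 + 2 * ε) * Complex.exp (inner ℂ f g) *
      ∫ p, φ p * gaussKernel (‖h₁‖ ^ 2 + 2 * ε) (‖h₂‖ ^ 2 + 2 * ε)
        (inner ℂ f (ofReal h₁) - inner ℂ (ofReal h₁) g)
        (inner ℂ f (ofReal h₂) + inner ℂ (ofReal h₂) g) p := by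
  have hA : 0 < ‖h₁‖ ^ 2 + 2 * ε := by positivity
  have hB : 0 < ‖h₂‖ ^ 2 + 2 * ε := by positivity
  have h : (fun w : ℝ × ℝ => inner ℂ (expVec f) (weylU (w.1 • h₁) (w.2 • h₂) (expVec g)) *
      (Real.exp (-ε * (w.1 ^ 2 + w.2 ^ 2)) : ℂ)) = fun w =>
      Complex.exp (inner ℂ f g - ((‖h₁‖ ^ 2 + 2 * ε : ℝ) * w.1 ^ 2 +
        (‖h₂‖ ^ 2 + 2 * ε : ℝ) * w.2 ^ 2) / 2 +
        w.1 * (inner ℂ f (ofReal h₁) - inner ℂ (ofReal h₁) g) +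
        Complex.I * (w.2 * (inner ℂ f (ofReal h₂) + inner ℂ (ofReal h₂) g))) := by
    funext w
    rw [inner_expVec_weylU, Complex.ofReal_exp, ← Complex.exp_add, norm_smul, norm_smul, mul_pow,
      mul_pow, Real.norm_eq_abs, Real.norm_eq_abs, sq_abs, sq_abs]
    simp only [inner_smul_ofReal_left, inner_smul_ofReal_right]
    congr 1
    push_cast
    ring
  rw [h, invFourierPairing]
  simp only [invFourier_gauss hA hB]
  rw [← integral_const_mul]
  refine integral_congr_ae (Eventually.of_forall fun p => ?_)
  simp only [gaussConst]
  ring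

/-! ### Linearity and translation of pairings, tempered functions and quantizations -/

theorem invFourierPairing_const_mul (φ F : ℝ × ℝ → ℂ) (c : ℂ) :
    invFourierPairing φ (fun w => c * F w) = c * invFourierPairing φ F := by
  rw [invFourierPairing, invFourierPairing, ← integral_const_mul]
  refine integral_congr_ae (Eventually.of_forall fun p => ?_)
  simp only [invFourier, mul_assoc, integral_const_mul]
  ring

theorem HasIntegralAgainst.const_mul {φ F : ℝ × ℝ → ℂ} {a : ℂ} (h : HasIntegralAgainst φ F a)
    (c : ℂ) : HasIntegralAgainst φ (fun w => c * F w) (c * a) := by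
  rw [HasIntegralAgainst] at h ⊢
  simpa only [mul_assoc, invFourierPairing_const_mul] using Filter.Tendsto.const_mul c h

theorem IsTempered.const_mul {φ : ℝ × ℝ → ℂ} (h : IsTempered φ) (c : ℂ) :
    IsTempered fun p => c * φ p := by
  obtain ⟨hm, N, hN⟩ := h
  exact ⟨hm.const_mul c, N, by simpa only [mul_div_assoc] using hN.const_mul c⟩

theorem aestronglyMeasurable_div_one_add_norm_pow {φ : ℝ × ℝ → ℂ} (h : AEStronglyMeasurable φ)
    (N : ℕ) : AEStronglyMeasurable fun p => φ p / ((1 + ‖p‖) ^ N : ℝ) := by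
  have hc : Continuous fun p : ℝ × ℝ => (((1 + ‖p‖) ^ N : ℝ) : ℂ) := by fun_prop
  exact (h.aemeasurable.div hc.aemeasurable).aestronglyMeasurable

theorem IsTempered.add {φ ψ : ℝ × ℝ → ℂ} (hφ : IsTempered φ) (hψ : IsTempered ψ) :
    IsTempered fun p => φ p + ψ p := by
  have mono : ∀ {χ : ℝ × ℝ → ℂ} {N M : ℕ}, AEStronglyMeasurable χ → N ≤ M →
      Integrable (fun p => χ p / ((1 + ‖p‖) ^ N : ℝ)) →
      Integrable (fun p => χ p / ((1 + ‖p‖) ^ M : ℝ)) := by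
    intro χ N M hm hNM h
    refine h.mono (aestronglyMeasurable_div_one_add_norm_pow hm M)
      (Eventually.of_forall fun p => ?_)
    rw [norm_div, norm_div, Complex.norm_real, Complex.norm_real,
      Real.norm_of_nonneg (by positivity), Real.norm_of_nonneg (by positivity)]
    gcongr
    exact le_add_of_nonneg_right (norm_nonneg p)
  obtain ⟨hm, N, hN⟩ := hφ
  obtain ⟨hm', N', hN'⟩ := hψ
  refine ⟨hm.add hm', max N N', ?_⟩
  have h := (mono hm (le_max_left N N') hN).add (mono hm' (le_max_right N N') hN')
  exact h.congr (Eventually.of_forall fun p => (add_div _ _ _).symm)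

theorem IsTempered.translate {φ : ℝ × ℝ → ℂ} (h : IsTempered φ) (x₀ y₀ : ℝ) :
    IsTempered (translate x₀ y₀ φ) := by
  obtain ⟨hm, N, hN⟩ := h
  have hmp : MeasurePreserving (fun p : ℝ × ℝ => p + (x₀, y₀)) :=
    measurePreserving_add_right volume (x₀, y₀)
  have hm' : AEStronglyMeasurable (QuantumWiener.translate x₀ y₀ φ) :=
    hm.comp_measurePreserving hmp
  refine ⟨hm', N, ?_⟩
  have h1 := ((hmp.integrable_comp hN.aestronglyMeasurable).2 hN).norm.mul_const
    ((1 + ‖((x₀, y₀) : ℝ × ℝ)‖) ^ N)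
  refine h1.mono' (aestronglyMeasurable_div_one_add_norm_pow hm' N)
    (Eventually.of_forall fun p => ?_)
  simp only [Function.comp_apply, QuantumWiener.translate]
  change ‖φ (p + (x₀, y₀)) / _‖ ≤ _
  rw [norm_div, norm_div, Complex.norm_real, Complex.norm_real,
    Real.norm_of_nonneg (by positivity), Real.norm_of_nonneg (by positivity), div_mul_eq_mul_div,
    div_le_div_iff₀ (by positivity) (by positivity), mul_assoc, ← mul_pow]
  gcongr
  -- The weight is submultiplicative: `1 + ‖p + v‖ ≤ (1 + ‖p‖) (1 + ‖v‖)`.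
  have := norm_add_le p (x₀, y₀)
  nlinarith [norm_nonneg p, norm_nonneg ((x₀, y₀) : ℝ × ℝ)]

/-- Translation of a function corresponds to modulation of its inverse Fourier transform. -/
theorem invFourierPairing_translate (x₀ y₀ : ℝ) (φ F : ℝ × ℝ → ℂ) :
    invFourierPairing (translate x₀ y₀ φ) F = invFourierPairing φ
      (fun w => Complex.exp (Complex.I * (w.1 * x₀ + w.2 * y₀)) * F w) := by
  rw [invFourierPairing, invFourierPairing, 
    ← integral_add_right_eq_self (fun p => φ p * _) ((x₀, y₀) : ℝ × ℝ)]
  refine integral_congr_ae (Eventually.of_forall fun p => ?_)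
  simp only [translate, invFourier, Prod.fst_add, Prod.snd_add]
  congr 2
  refine integral_congr_ae (Eventually.of_forall fun w => ?_)
  simp only
  rw [mul_comm (Complex.exp _) (F w), mul_assoc, ← Complex.exp_add]
  congr 2
  push_cast
  ring

theorem IsWeylQuantization.const_mul {h₁ h₂ : E} {φ : ℝ × ℝ → ℂ}
    {M : Fock (Complexification E) →L[ℂ] Fock (Complexification E)}
    (hM : IsWeylQuantization h₁ h₂ φ M) (c : ℂ) :
    IsWeylQuantization h₁ h₂ (fun p => c * φ p) (c • M) := by
  refine ⟨hM.1.const_mul c, fun f g => ?_⟩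
  have h := Filter.Tendsto.const_mul c (hM.2 f g)
  rw [HasIntegralAgainst]
  rw [smul_apply, inner_smul_right, mul_left_comm]
  refine h.congr fun ε => ?_
  simp only [invFourierPairing, mul_assoc, integral_const_mul]

theorem IsWeylQuantization.add {h₁ h₂ : E} {φ ψ : ℝ × ℝ → ℂ}
    {M N : Fock (Complexification E) →L[ℂ] Fock (Complexification E)}
    (hM : IsWeylQuantization h₁ h₂ φ M) (hN : IsWeylQuantization h₁ h₂ ψ N) :
    IsWeylQuantization h₁ h₂ (fun p => φ p + ψ p) (M + N) := by
  refine ⟨hM.1.add hN.1, fun f g => ?_⟩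
  have h := Filter.Tendsto.add (hM.2 f g) (hN.2 f g)
  rw [← mul_add, ← inner_add_right] at h
  -- Unlike scaling, additivity needs convergent integrals. For `ε > 0` the kernel is Schwartz and
  -- they converge.
  refine h.congr' ?_
  filter_upwards [self_mem_nhdsWithin] with ε hε
  have hε : 0 < ε := hε
  have hA : 0 < ‖h₁‖ ^ 2 + 2 * ε := by positivity
  have hB : 0 < ‖h₂‖ ^ 2 + 2 * ε := by positivity
  rw [invFourierPairing_weylU _ _ _ _ _ hε, invFourierPairing_weylU _ _ _ _ _ hε,
    invFourierPairing_weylU _ _ _ _ _ hε, ← mul_add]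
  congr 1
  simp only [← gaussSchwartz_apply hA hB, add_mul]
  exact (integral_add (hM.1.integrable_mul_schwartz _) (hN.1.integrable_mul_schwartz _)).symm

/-! ### Conjugation with Weyl operators -/

theorem adjoint_weyl {K : Type*} [NormedAddCommGroup K] [InnerProductSpace ℂ K] (z : K) :
    ContinuousLinearMap.adjoint (weyl z) = weyl (-z) := by
  refine ext_of_inner_expVec fun f g => ?_
  rw [ContinuousLinearMap.adjoint_inner_right, weyl_expVec, weyl_expVec, weylVec, weylVec,
    inner_smul_left, inner_smul_right, inner_expVec, inner_expVec, ← Complex.exp_conj,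
    ← Complex.exp_add, ← Complex.exp_add]
  congr 1
  simp only [map_sub, map_neg, map_div₀, inner_conj_symm, inner_add_left, inner_add_right,
    Complex.conj_ofNat, inner_neg_left, inner_neg_right]
  ring

theorem adjoint_weylU (h₁ h₂ : E) :
    ContinuousLinearMap.adjoint (weylU h₁ h₂) = weylU (-h₁) (-h₂) := by
  have hre : ∀ x : Complexification E, (-x).re = -x.re := fun _ => rfl
  have him : ∀ x : Complexification E, (-x).im = -x.im := fun _ => rfl
  rw [weylU, weylU, adjoint_weyl]
  congr 1
  apply Complexification.ext
  · simp [ofReal, hre]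
  · simp [ofReal, him]

/-- The two phases of the Weyl relation add up, whence the factor 2 that the halves in the
proposition cancel. -/
theorem weylU_conj_weylU (h₁ h₂ k₁ k₂ : E) :
    weylU k₁ k₂ ∘L weylU h₁ h₂ ∘L ContinuousLinearMap.adjoint (weylU k₁ k₂) =
      Complex.exp (Complex.I * (2 * (inner ℝ k₂ h₁ - inner ℝ k₁ h₂) : ℝ)) • weylU h₁ h₂ := by
  rw [adjoint_weylU, weylU_comp_weylU, ContinuousLinearMap.comp_smul, weylU_comp_weylU, smul_smul,
    ← Complex.exp_add]
  congr 2
  · simp [inner_add_right, inner_neg_right, real_inner_comm]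
    ring
  · abel
  · abel

theorem IsWeylQuantization.translate {h₁ h₂ : E} {φ : ℝ × ℝ → ℂ}
    {M : Fock (Complexification E) →L[ℂ] Fock (Complexification E)}
    (hM : IsWeylQuantization h₁ h₂ φ M) (k₁ k₂ : E) :
    IsWeylQuantization h₁ h₂ (translate (inner ℝ k₁ h₁) (inner ℝ k₂ h₂) φ)
      (weylU (-(1 / 2 : ℝ) • k₂) ((1 / 2 : ℝ) • k₁) ∘L M ∘L
        ContinuousLinearMap.adjoint (weylU (-(1 / 2 : ℝ) • k₂) ((1 / 2 : ℝ) • k₁))) := by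
  refine ⟨hM.1.translate _ _, fun f g => ?_⟩
  let W : Fock (Complexification E) →L[ℂ] Fock (Complexification E) :=
    weylU (-(1 / 2 : ℝ) • k₂) ((1 / 2 : ℝ) • k₁)
  have hW : ∀ f, ∃ (c : ℂ) (f' : Complexification E),
      ContinuousLinearMap.adjoint W (expVec f) = c • expVec f' := fun f => by
    simp only [W, weylU]
    rw [adjoint_weyl, weyl_expVec]
    exact ⟨_, _, rfl⟩
  obtain ⟨c, f', hf⟩ := hW f
  obtain ⟨d, g', hg⟩ := hW g
  -- The adjoint of `W` maps exponential vectors to multiples of exponential vectors. The same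
  -- scalar and the same `f'`, `g'` serve every `B`, so this applies to `M` and to each Weyl
  -- operator under the integral.
  have hinner : ∀ B : Fock (Complexification E) →L[ℂ] Fock (Complexification E),
      inner ℂ (expVec f) ((W ∘L B ∘L ContinuousLinearMap.adjoint W) (expVec g)) =
        conj c * d * inner ℂ (expVec f') (B (expVec g')) := by
    intro B
    rw [ContinuousLinearMap.comp_apply, ContinuousLinearMap.comp_apply,
      ← ContinuousLinearMap.adjoint_inner_left, hf, hg, map_smul, inner_smul_left,
      inner_smul_right, mul_assoc]
  have h := (hM.2 f' g').const_mul (conj c * d)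
  rw [HasIntegralAgainst] at h ⊢
  rw [hinner, mul_left_comm]
  refine h.congr fun ε => ?_
  rw [invFourierPairing_translate]
  congr 1
  funext w
  rw [← hinner, weylU_conj_weylU, smul_apply, inner_smul_right, mul_assoc]
  congr 3
  simp only [real_inner_smul_left, real_inner_smul_right]
  push_cast
  ring

/-! ### Commutators with position and momentum operators -/

theorem creationVec_add {K : Type*} [NormedAddCommGroup K] [InnerProductSpace ℂ K] (h k f : K) :
    creationVec (h + k) f = creationVec h f + creationVec k f :=
  eq_of_inner_expVec fun e => by
    simp only [inner_add_right, inner_expVec_creationVec, add_mul]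

theorem creationVec_smul {K : Type*} [NormedAddCommGroup K] [InnerProductSpace ℂ K] (c : ℂ)
    (h f : K) : creationVec (c • h) f = c • creationVec h f :=
  eq_of_inner_expVec fun e => by
    simp only [inner_smul_right, inner_expVec_creationVec, mul_assoc]

theorem conjugate_conjugate {V : Type*} [NormedAddCommGroup V] (k : Complexification V) :
    k.conjugate.conjugate = k := by
  simp [conjugate]

theorem position_sub_momentum_toFun (k₁ k₂ g : Complexification E) :
    (position k₁.conjugate - momentum k₂.conjugate).toFun g =
      inner ℂ (k₁ + Complex.I • k₂) g • expVec g +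
        creationVec (k₁.conjugate + Complex.I • k₂.conjugate) g := by
  change (inner ℂ k₁.conjugate.conjugate g • expVec g + creationVec k₁.conjugate g) -
    Complex.I • (inner ℂ k₂.conjugate.conjugate g • expVec g - creationVec k₂.conjugate g) = _
  rw [conjugate_conjugate, conjugate_conjugate, creationVec_add, creationVec_smul, inner_add_left,
    inner_smul_left, Complex.conj_I]
  module

theorem position_sub_momentum_adj (k₁ k₂ f : Complexification E) :
    (position k₁.conjugate - momentum k₂.conjugate).adj f =
      creationVec (k₁ + Complex.I • k₂) f +
        inner ℂ (k₁.conjugate + Complex.I • k₂.conjugate) f • expVec f := by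
  change (creationVec k₁.conjugate.conjugate f + inner ℂ k₁.conjugate f • expVec f) -
    conj Complex.I • (creationVec k₂.conjugate.conjugate f -
      inner ℂ k₂.conjugate f • expVec f) = _
  rw [conjugate_conjugate, conjugate_conjugate, creationVec_add, creationVec_smul, inner_add_left,
    inner_smul_left, Complex.conj_I]
  module

/-- Removing the factor `exp ⟪f, g⟫` leaves Gaussian means that depend on `f` and `g` through `α`
and `β` only. The constant `gaussConst` may diverge as `ε → 0` but is common to all functions, so it
is never evaluated. -/
theorem IsWeylQuantization.tendsto_integral_gaussKernel {h₁ h₂ : E} {φ : ℝ × ℝ → ℂ}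
    {M : Fock (Complexification E) →L[ℂ] Fock (Complexification E)}
    (hM : IsWeylQuantization h₁ h₂ φ M) (f g : Complexification E) :
    Tendsto (fun ε : ℝ => gaussConst (‖h₁‖ ^ 2 + 2 * ε) (‖h₂‖ ^ 2 + 2 * ε) *
      ∫ p, φ p * gaussKernel (‖h₁‖ ^ 2 + 2 * ε) (‖h₂‖ ^ 2 + 2 * ε)
        (inner ℂ f (ofReal h₁) - inner ℂ (ofReal h₁) g)
        (inner ℂ f (ofReal h₂) + inner ℂ (ofReal h₂) g) p) (𝓝[>] 0)
      (𝓝 (Complex.exp (-inner ℂ f g) * (2 * Real.pi * inner ℂ (expVec f) (M (expVec g))))) := by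
  refine ((hM.2 f g).const_mul (Complex.exp (-inner ℂ f g))).congr' ?_
  filter_upwards [self_mem_nhdsWithin] with ε hε
  simp only [mul_assoc, invFourierPairing_const_mul]
  rw [invFourierPairing_weylU _ _ _ _ _ hε]
  have h : Complex.exp (-inner ℂ f g) * Complex.exp (inner ℂ f g) = 1 := by
    rw [← Complex.exp_add, neg_add_cancel, Complex.exp_zero]
  linear_combination (gaussConst (‖h₁‖ ^ 2 + 2 * ε) (‖h₂‖ ^ 2 + 2 * ε) *
    ∫ p, φ p * gaussKernel (‖h₁‖ ^ 2 + 2 * ε) (‖h₂‖ ^ 2 + 2 * ε)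
        (inner ℂ f (ofReal h₁) - inner ℂ (ofReal h₁) g)
        (inner ℂ f (ofReal h₂) + inner ℂ (ofReal h₂) g) p) * h

theorem IsWeylQuantization.commutatorDefines {h₁ h₂ : E} {φ φx φy : ℝ × ℝ → ℂ}
    {M Mx My : Fock (Complexification E) →L[ℂ] Fock (Complexification E)}
    (hM : IsWeylQuantization h₁ h₂ φ M) (hMx : IsWeylQuantization h₁ h₂ φx Mx)
    (hMy : IsWeylQuantization h₁ h₂ φy My) (hx : IsWeakDeriv (1, 0) φ φx)
    (hy : IsWeakDeriv (0, 1) φ φy) (k₁ k₂ : Complexification E) :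
    CommutatorDefines (position k₁.conjugate - momentum k₂.conjugate) M
      ((-(2 * Complex.I)) • (inner ℂ k₁ (ofReal h₁) • Mx + inner ℂ k₂ (ofReal h₂) • My)) := by
  intro f g
  rw [position_sub_momentum_adj, position_sub_momentum_toFun]
  -- These two combinations are the velocities of `α` and `β` along the line chosen below. In each
  -- of them one of the vectors `k₁`, `k₂` cancels.
  have hp₁ : inner ℂ (k₁ + Complex.I • k₂) (ofReal h₁) +
      inner ℂ (ofReal h₁) (k₁.conjugate + Complex.I • k₂.conjugate) =
      2 * inner ℂ k₁ (ofReal h₁) := by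
    rw [inner_add_left, inner_add_right, inner_smul_left, inner_smul_right,
      inner_ofReal_conjugate, inner_ofReal_conjugate, Complex.conj_I]
    ring
  have hp₂ : inner ℂ (k₁ + Complex.I • k₂) (ofReal h₂) -
      inner ℂ (ofReal h₂) (k₁.conjugate + Complex.I • k₂.conjugate) =
      -(2 * Complex.I * inner ℂ k₂ (ofReal h₂)) := by
    rw [inner_add_left, inner_add_right, inner_smul_left, inner_smul_right,
      inner_ofReal_conjugate, inner_ofReal_conjugate, Complex.conj_I]
    ring
  generalize k₁ + Complex.I • k₂ = p at *
  generalize k₁.conjugate + Complex.I • k₂.conjugate = q at *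
  generalize inner ℂ k₁ (ofReal h₁) = c₁ at *
  generalize inner ℂ k₂ (ofReal h₂) = c₂ at *
  -- The conjugate makes pairings with `F t` in the first slot holomorphic. The sign of `q` in `G`
  -- produces the minus sign of the commutator.
  let F : ℂ → Complexification E := fun t => f + conj t • p
  let G : ℂ → Complexification E := fun t => g + t • -q
  -- Differentiating the normalizing exponential at `t = 0` yields the annihilation part of the
  -- commutator, and differentiating the exponential vectors yields the creation part.
  let m : (Fock (Complexification E) →L[ℂ] Fock (Complexification E)) → ℂ → ℂ := fun B t =>
    Complex.exp (-inner ℂ (F t) (G t)) * (2 * Real.pi * inner ℂ (expVec (F t)) (B (expVec (G t))))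
  have hFG : ∀ t, inner ℂ (F t) (G t) =
      inner ℂ f g + t * (inner ℂ p g - inner ℂ f q) - t ^ 2 * inner ℂ p q := fun t => by
    simp only [F, G, inner_add_left, inner_add_right, inner_smul_left, inner_smul_right,
      Complex.conj_conj, inner_neg_right]
    ring
  have hm : ∀ B t, HasDerivAt (m B)
      (Complex.exp (-inner ℂ (F t) (G t)) *
          (-(inner ℂ p g - inner ℂ f q - 2 * t * inner ℂ p q)) *
          (2 * Real.pi * inner ℂ (expVec (F t)) (B (expVec (G t)))) +
        Complex.exp (-inner ℂ (F t) (G t)) * (2 * Real.pi *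
          (inner ℂ (creationVec p (F t)) (B (expVec (G t))) +
            inner ℂ (expVec (F t)) (B (creationVec (-q) (G t)))))) t := by
    intro B t
    refine HasDerivAt.mul (HasDerivAt.cexp ?_)
      ((hasDerivAt_inner_expVec B f g p (-q) t).const_mul _)
    simp only [hFG]
    have h := ((((hasDerivAt_id t).mul_const (inner ℂ p g - inner ℂ f q)).const_add
      (inner ℂ f g)).sub (((hasDerivAt_id t).pow 2).mul_const (inner ℂ p q))).neg
    refine h.congr_deriv ?_
    simp
  have hmd : ∀ B, Differentiable ℂ (m B) := fun B t => (hm B t).differentiableAt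
  -- The Baire argument needs countably many functions, hence a sequence of dampings.
  let ε : ℕ → ℝ := fun n => 1 / (n + 1)
  have hε : ∀ n, 0 < ε n := fun n => by positivity
  have hεlim : Tendsto ε atTop (𝓝[>] 0) := tendsto_nhdsWithin_iff.2
    ⟨tendsto_one_div_add_atTop_nhds_zero_nat, Eventually.of_forall hε⟩
  let A : ℕ → ℝ := fun n => ‖h₁‖ ^ 2 + 2 * ε n
  let B : ℕ → ℝ := fun n => ‖h₂‖ ^ 2 + 2 * ε n
  have hA : ∀ n, 0 < A n := fun n => add_pos_of_nonneg_of_pos (by positivity) (by linarith [hε n])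
  have hB : ∀ n, 0 < B n := fun n => add_pos_of_nonneg_of_pos (by positivity) (by linarith [hε n])
  let α : ℂ := inner ℂ f (ofReal h₁) - inner ℂ (ofReal h₁) g
  let β : ℂ := inner ℂ f (ofReal h₂) + inner ℂ (ofReal h₂) g
  let J : (ℝ × ℝ → ℂ) → ℕ → ℂ → ℂ := fun χ n t => gaussConst (A n) (B n) *
    ∫ p, χ p * gaussKernel (A n) (B n) (α + t * (2 * c₁)) (β + t * -(2 * Complex.I * c₂)) p
  have hJlim : ∀ {χ N}, IsWeylQuantization h₁ h₂ χ N → ∀ t,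
      Tendsto (fun n => J χ n t) atTop (𝓝 (m N t)) := by
    intro χ N hN t
    refine ((hN.tendsto_integral_gaussKernel (F t) (G t)).comp hεlim).congr fun n => ?_
    have e₁ : inner ℂ (F t) (ofReal h₁) - inner ℂ (ofReal h₁) (G t) = α + t * (2 * c₁) := by
      simp only [F, G, α, ← hp₁, inner_add_left, inner_add_right, inner_smul_left,
        inner_smul_right, Complex.conj_conj, inner_neg_right]
      ring
    have e₂ : inner ℂ (F t) (ofReal h₂) + inner ℂ (ofReal h₂) (G t) =
        β + t * -(2 * Complex.I * c₂) := by
      simp only [F, G, β, ← hp₂, inner_add_left, inner_add_right, inner_smul_left,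
        inner_smul_right, Complex.conj_conj, inner_neg_right]
      ring
    simp only [Function.comp_apply, e₁, e₂, J, A, B]
  have hJd : ∀ n t, HasDerivAt (J φ n) (-(2 * Complex.I) * (c₁ * J φx n t + c₂ * J φy n t)) t := by
    intro n t
    refine ((hasDerivAt_integral_gaussKernel (hA n) (hB n) hM.1 hx hy α β (2 * c₁)
      (-(2 * Complex.I * c₂)) t).const_mul _).congr_deriv ?_
    simp only [J]
    ring
  -- Pointwise convergence of the derivatives is exactly the hypothesis that `φx` and `φy` have
  -- bounded quantizations.
  have key := congrFun (deriv_eq_of_tendsto (F := J φ) (G := m M)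
    (H := fun t => -(2 * Complex.I) * (c₁ * m Mx t + c₂ * m My t))
    (fun n t => (hJd n t).differentiableAt) (hmd M)
    (by
      have h₁ := (hmd Mx).continuous
      have h₂ := (hmd My).continuous
      fun_prop)
    (hJlim hM) fun t => by
      simp only [(hJd _ t).deriv]
      exact (((hJlim hMx t).const_mul _).add ((hJlim hMy t).const_mul _)).const_mul _) 0
  rw [(hm M 0).deriv] at key
  have hneg : creationVec (-q) g = -creationVec q g := by
    rw [← neg_one_smul ℂ q, creationVec_smul, neg_one_smul]
  simp only [m, F, G, map_zero, zero_smul, add_zero, hneg, map_neg, inner_neg_right, mul_zero,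
    zero_mul, sub_zero] at key
  have he : Complex.exp (-inner ℂ f g) * (2 * Real.pi) ≠ 0 :=
    mul_ne_zero (Complex.exp_ne_zero _) (by simp [Real.pi_ne_zero])
  refine mul_left_cancel₀ he ?_
  simp only [smul_apply, add_apply, inner_smul_right, inner_smul_left, inner_add_left,
    inner_add_right, map_add, map_smul, inner_conj_symm]
  linear_combination -key

end WeylCalculus

end QuantumWiener

/-! ### The proposition -/

theorem mainTheorem12 {E : Type*} [NormedAddCommGroup E] [InnerProductSpace ℝ E]
    [CompleteSpace E] (h₁ h₂ : E) :
    (∀ (k₁ k₂ : E) (φ : ℝ × ℝ → ℂ), φ ∈ weylDomain h₁ h₂ →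
      translate (inner ℝ k₁ h₁) (inner ℝ k₂ h₂) φ ∈ weylDomain h₁ h₂ ∧
      weylU (-(1 / 2 : ℝ) • k₂) ((1 / 2 : ℝ) • k₁) ∘L weylOp h₁ h₂ φ ∘L
          ContinuousLinearMap.adjoint (weylU (-(1 / 2 : ℝ) • k₂) ((1 / 2 : ℝ) • k₁)) =
        weylOp h₁ h₂ (translate (inner ℝ k₁ h₁) (inner ℝ k₂ h₂) φ)) ∧
    (∀ (k₁ k₂ : Complexification E) (φ φx φy : ℝ × ℝ → ℂ), φ ∈ weylDomain h₁ h₂ →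
      φx ∈ weylDomain h₁ h₂ → φy ∈ weylDomain h₁ h₂ →
      IsWeakDeriv (1, 0) φ φx → IsWeakDeriv (0, 1) φ φy →
      (fun p => inner ℂ k₁ (Complexification.ofReal h₁) * φx p +
          inner ℂ k₂ (Complexification.ofReal h₂) * φy p) ∈ weylDomain h₁ h₂ ∧
      ∃ C : Fock (Complexification E) →L[ℂ] Fock (Complexification E),
        CommutatorDefines (position k₁.conjugate - momentum k₂.conjugate) (weylOp h₁ h₂ φ) C ∧
        (Complex.I / 2) • C =
          weylOp h₁ h₂ (fun p => inner ℂ k₁ (Complexification.ofReal h₁) * φx p +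
            inner ℂ k₂ (Complexification.ofReal h₂) * φy p)) := by
  refine ⟨fun k₁ k₂ φ hφ => ?_, fun k₁ k₂ φ φx φy hφ hφx hφy hx hy => ?_⟩
  -- At `rfl`, `weylOp_eq_iff` says that the chosen operator satisfies its defining relation.
  · have h := ((weylOp_eq_iff hφ _).1 rfl).translate k₁ k₂
    exact ⟨⟨_, h⟩, ((weylOp_eq_iff ⟨_, h⟩ _).2 h).symm⟩
  · have hMx := (weylOp_eq_iff hφx _).1 rfl
    have hMy := (weylOp_eq_iff hφy _).1 rfl
    have h := (hMx.const_mul (inner ℂ k₁ (Complexification.ofReal h₁))).add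
      (hMy.const_mul (inner ℂ k₂ (Complexification.ofReal h₂)))
    refine ⟨⟨_, h⟩, _, ((weylOp_eq_iff hφ _).1 rfl).commutatorDefines hMx hMy hx hy k₁ k₂, ?_⟩
    rw [(weylOp_eq_iff ⟨_, h⟩ _).2 h, smul_smul]
    -- The operator `C` is `-2 i` times the quantized directional derivative, so `i / 2` normalizes
    -- it.
    have : Complex.I / 2 * -(2 * Complex.I) = 1 := by
      linear_combination -Complex.I_sq
    rw [this, one_smul]
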